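/- Let $V$ be a real vector space of dimension $N\ge 2$ with a Lorentzian metric $g_{ab}$ of signature $(+,-,\dots,-)$ (a tangent space of a Lorentzian manifold); indices are raised with $g$. For a $p$-form $\Omega$ write $\Omega\cdot\Omega=\Omega_{a_1\dots a_p}\Omega^{a_1\dots a_p}$ and, for $p\ge1$, $(\Omega\odot\Omega)_{ab}=\frac{(-1)^{p-1}}{(p-1)!}\,\Omega_{ac_2\dots c_p}\Omega_b{}^{c_2\dots c_p}$. The superenergy tensor of $\Omega$ is $T_{ab}\{\Omega\}=\frac12\big(\Omega\odot\Omega+{*\Omega}\odot{*\Omega}\big)_{ab}$ for $1\le p\le N-1$, where $*$ is the Hodge dual, and $T_{ab}\{\Omega\}=\frac12 h^2g_{ab}$ for an $N$-form $\Omega=h\eta$, where $\eta$ is the canonical volume form. A $p$-form is simple if it is the exterior product of $p$ linearly independent 1-forms, and null if it is simple and $\Omega\cdot\Omega=0$. Let $\mathcal{SS}$ (respectively $\mathcal{NS}$) be the set of superenergy tensors of simple (respectively null) $p$-forms, $1\le p\le N$, and let $-\mathcal{SS}$, $-\mathcal{NS}$ be the sets of their negatives. A 1-form $k$ is null if $k\ne0$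 and $k_ak^a=0$, and causal if $k\neq 0$ and $k_ak^a\ge0$. Say that a simple $p$-form is of causal type if it is a causal 1-form when $p=1$, and an exterior product of $p$ linearly independent null 1-forms when $p\ge2$. Theorem. Let $T_{ab}$ be a symmetric tensor with $(T\times T)_{ab}:=T_{ac}T_b{}^c=f\,g_{ab}$ for a real number $f$; if $N=2$, assume also $f\ge0$. Then: (a) If $f=0$, then $T_{ab}=\beta k_ak_b$ for some real $\beta$ and some null $k$, and, if $T\ne0$, then $T\in\mathcal{NS}\cup-\mathcal{NS}$. (b) If $f\ne0$, then $f>0$ and there is a sign $\epsilon=\pm1$ with $\epsilon T\in\mathcal{SS}$ and $\epsilon T_a{}^a=(2p-N)\sqrt f$ for some $p\in\{1,\dots,N\}$. Moreover, for this $\epsilon$ and for every $p\in\{1,\dots,N\}$, one has $\epsilon T_a{}^a=(2p-N)\sqrt f$ if and only if $\epsilon T_{ab}=T_{ab}\{\Omega\}$ for some simple $p$-form $\Omega$ of causal type. -/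

import Mathlib

namespace SuperEnergy

open Module

variable {V : Type*} [AddCommGroup V] [Module ℝ V] {N : ℕ}

/-- The diagonal entries of the Minkowski metric, signature `(+, -, …, -)`. -/
def sgn (i : Fin N) : ℝ := if (i : ℕ) = 0 then 1 else -1

/-- `e` is an orthonormal frame of the bilinear form `g` with signature `(+, -, …, -)`.
A Lorentzian metric on an `N`-dimensional space is a form which has such a frame. -/
def IsOrthonormalFrame (g : LinearMap.BilinForm ℝ V) (e : Basis (Fin N) ℝ V) : Prop :=
  ∀ i j, g (e i) (e j) = if i = j then sgn i else 0

/-! Below, `e` is an orthonormal frame of the metric.  In it the inverse metric has the components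
`g^{ij} = sgn i * δ^{ij}`, so that contracting a pair of indices amounts to inserting `e i` in both
places and summing over `i` with the weight `sgn i`. -/

/-- The trace `T_a^a`. -/
noncomputable def metricTrace (e : Basis (Fin N) ℝ V) (T : LinearMap.BilinForm ℝ V) : ℝ :=
  ∑ i, sgn i * T (e i) (e i)

/-- The product `(S × T)_{ab} = S_{ac} T_b^c` of symmetric tensors. -/
noncomputable def cross (e : Basis (Fin N) ℝ V) (S T : LinearMap.BilinForm ℝ V) (u v : V) : ℝ :=
  ∑ i, sgn i * S u (e i) * T v (e i)

/-- The scalar product `α_a β^a` of 1-forms. -/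
noncomputable def dot (e : Basis (Fin N) ℝ V) (α β : Dual ℝ V) : ℝ :=
  ∑ i, sgn i * α (e i) * β (e i)

/-- A null 1-form: non-zero, with vanishing square. -/
def IsNull (e : Basis (Fin N) ℝ V) (k : Dual ℝ V) : Prop :=
  k ≠ 0 ∧ dot e k k = 0

/-- The full contraction `Ω ⬝ Ω' = Ω_{a₁…a_p} Ω'^{a₁…a_p}` of two `p`-forms. -/
noncomputable def formDot (e : Basis (Fin N) ℝ V) {p : ℕ} (Ω Ω' : V [⋀^Fin p]→ₗ[ℝ] ℝ) : ℝ :=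
  ∑ I : Fin p → Fin N,
    (∏ k, sgn (I k)) * Ω (fun k => e (I k)) * Ω' (fun k => e (I k))

/-- The product
`(Ω ⊙ Ω)_{ab} = ((-1)^(p-1) / (p-1)!) Ω_{a c₂…c_p} Ω_b^{c₂…c_p}` for a `p`-form, `p ≥ 1`
(with the value `0`, which is never used, for `p = 0`). -/
noncomputable def odot (e : Basis (Fin N) ℝ V) :
    {p : ℕ} → V [⋀^Fin p]→ₗ[ℝ] ℝ → V → V → ℝ
  | 0, _, _, _ => 0
  | q + 1, Ω, u, v =>
    (-1 : ℝ) ^ q / (q.factorial : ℝ) *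
      ∑ I : Fin q → Fin N, (∏ k, sgn (I k)) *
        Ω (Fin.cons u fun k => e (I k)) * Ω (Fin.cons v fun k => e (I k))

/-- The `m`-form `v ↦ η(a₁, …, a_p, v₁, …, v_m)`, where `p + m = N` and `η = e.det` is the
canonical volume form of the orthonormal frame. -/
noncomputable def volumeInsert (e : Basis (Fin N) ℝ V) {p m : ℕ} (h : p + m = N)
    (a : Fin p → V) : V [⋀^Fin m]→ₗ[ℝ] ℝ where
  toFun v := e.det fun i => Fin.append a v (Fin.cast h.symm i)
  map_update_add' := by
    intro _ v i x y
    subst h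
    have key : ∀ z : V, Fin.append a (Function.update v i z) =
        Function.update (Fin.append a v) (Fin.natAdd p i) z := by
      intro z
      funext j
      refine Fin.addCases (fun j => ?_) (fun j => ?_) j
      · rw [Function.update_of_ne (by
          intro hj
          have := congrArg Fin.val hj
          simp at this
          omega)]
        simp
      · by_cases hj : j = i
        · subst hj; simp
        · rw [Function.update_of_ne (by simpa using hj)]
          simp [hj]
    have : ‹DecidableEq (Fin m)› = instDecidableEqFin m := Subsingleton.elim _ _
    subst this
    simp only [Fin.cast_eq_self, key]
    exact e.det.map_update_add _ _ _ _
  map_update_smul' := by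
    intro _ v i c x
    subst h
    have key : ∀ z : V, Fin.append a (Function.update v i z) =
        Function.update (Fin.append a v) (Fin.natAdd p i) z := by
      intro z
      funext j
      refine Fin.addCases (fun j => ?_) (fun j => ?_) j
      · rw [Function.update_of_ne (by
          intro hj
          have := congrArg Fin.val hj
          simp at this
          omega)]
        simp
      · by_cases hj : j = i
        · subst hj; simp
        · rw [Function.update_of_ne (by simpa using hj)]
          simp [hj]
    have : ‹DecidableEq (Fin m)› = instDecidableEqFin m := Subsingleton.elim _ _
    subst this
    simp only [Fin.cast_eq_self, key]
    exact e.det.map_update_smul _ _ _ _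
  map_eq_zero_of_eq' := by
    intro v i j hv hij
    subst h
    refine e.det.map_eq_zero_of_eq (i := Fin.natAdd p i) (j := Fin.natAdd p j) _ ?_ ?_
    · simpa using hv
    · simpa using hij

/-- The Hodge dual `(*Ω)_{b₁…b_m} = (1/p!) η_{a₁…a_p b₁…b_m} Ω^{a₁…a_p}` of a `p`-form,
where `m = N - p`. -/
noncomputable def hodgeDual (e : Basis (Fin N) ℝ V) {p m : ℕ} (h : p + m = N)
    (Ω : V [⋀^Fin p]→ₗ[ℝ] ℝ) : V [⋀^Fin m]→ₗ[ℝ] ℝ :=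
  (1 / (p.factorial : ℝ)) • ∑ I : Fin p → Fin N,
    ((∏ k, sgn (I k)) * Ω (fun k => e (I k))) • volumeInsert e h (fun k => e (I k))

/-- The superenergy tensor `T_{ab}{Ω}` of a `p`-form, `1 ≤ p ≤ N`: half the sum of `Ω ⊙ Ω` and
`*Ω ⊙ *Ω` if `p < N`, and `(1/2) f² g_{ab}` for the `N`-form `Ω = f η`. -/
noncomputable def superenergy (g : LinearMap.BilinForm ℝ V) (e : Basis (Fin N) ℝ V) {p : ℕ}
    (Ω : V [⋀^Fin p]→ₗ[ℝ] ℝ) (u v : V) : ℝ :=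
  if h : p < N then
    1 / 2 * (odot e Ω u v + odot e (hodgeDual e (Nat.add_sub_of_le h.le) Ω) u v)
  else if h : p = N then
    1 / 2 * (Ω fun i => e (Fin.cast h i)) ^ 2 * g u v
  else 0

/-- The `p`-form `ω¹ ∧ … ∧ ω^p`, `(v₁, …, v_p) ↦ det (ω^j (v_i))`. -/
noncomputable def wedge {p : ℕ} (ω : Fin p → Dual ℝ V) : V [⋀^Fin p]→ₗ[ℝ] ℝ :=
  (Matrix.detRowAlternating (n := Fin p) (R := ℝ)).compLinearMap (LinearMap.pi ω)

/-- A simple `p`-form: the exterior product of `p` linearly independent 1-forms. -/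
def IsSimple {p : ℕ} (Ω : V [⋀^Fin p]→ₗ[ℝ] ℝ) : Prop :=
  ∃ ω : Fin p → Dual ℝ V, LinearIndependent ℝ ω ∧ Ω = wedge ω

/-- A null `p`-form: simple, with `Ω ⬝ Ω = 0`. -/
def IsNullForm (e : Basis (Fin N) ℝ V) {p : ℕ} (Ω : V [⋀^Fin p]→ₗ[ℝ] ℝ) : Prop :=
  IsSimple Ω ∧ formDot e Ω Ω = 0

/-- A simple `p`-form of causal type: a causal 1-form if `p = 1`, and the exterior product of
`p` (linearly independent) null 1-forms if `p > 1`. -/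
def IsCausalSimple (e : Basis (Fin N) ℝ V) {p : ℕ} (Ω : V [⋀^Fin p]→ₗ[ℝ] ℝ) : Prop :=
  ∃ ω : Fin p → Dual ℝ V, LinearIndependent ℝ ω ∧ Ω = wedge ω ∧
    (p = 1 → ∀ i, 0 ≤ dot e (ω i) (ω i)) ∧ (1 < p → ∀ i, IsNull e (ω i))

/-- The set of superenergy tensors of simple `p`-forms, `1 ≤ p ≤ N`. -/
def SS (g : LinearMap.BilinForm ℝ V) (e : Basis (Fin N) ℝ V) : Set (LinearMap.BilinForm ℝ V) :=
  {T | ∃ p : ℕ, 1 ≤ p ∧ p ≤ N ∧ ∃ Ω : V [⋀^Fin p]→ₗ[ℝ] ℝ,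
    IsSimple Ω ∧ ∀ u v, T u v = superenergy g e Ω u v}

/-- The set of superenergy tensors of null `p`-forms, `1 ≤ p ≤ N`. -/
def NS (g : LinearMap.BilinForm ℝ V) (e : Basis (Fin N) ℝ V) : Set (LinearMap.BilinForm ℝ V) :=
  {T | ∃ p : ℕ, 1 ≤ p ∧ p ≤ N ∧ ∃ Ω : V [⋀^Fin p]→ₗ[ℝ] ℝ,
    IsNullForm e Ω ∧ ∀ u v, T u v = superenergy g e Ω u v}

end SuperEnergy

namespace SuperEnergy

open Module

variable {V : Type*} [AddCommGroup V] [Module ℝ V] {N : ℕ}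

/-! Raising an index turns `T` into a `g`-self-adjoint endomorphism `A`, and the hypothesis becomes
`A² = f`, i.e. `g (A u) (A v) = f * g u v`. All the causal geometry comes from one fact: a vector
orthogonal to a timelike one and not spacelike is zero (`IsOrthonormalFrame.eq_zero_of_orthogonal`).

If `f = 0`, the image of `A` consists of mutually orthogonal null vectors. These are all parallel,
so `T = β k ⊗ k` (`exists_null_of_cross_eq_zero`). A null 1-form `k` has superenergy tensor `k ⊗ k`,
which absorbs `|β|` after rescaling.

If `f > 0`, then for timelike `u` one of the vectors `√f u ± A u` is a timelike eigenvector.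
Choosing `ε` accordingly, its eigenspace `W` has an adapted orthonormal frame, in which `ε T = √f
(g|_W - g|_{W^⊥})` (`exists_frame_diag`). A simple `p`-form whose span contains a timelike direction
has, in a frame adapted to that span, a superenergy tensor of this same shape (`superenergy_wedge`).
Null 1-forms spanning `W` (one timelike 1-form if `dim W = 1`), suitably scaled, therefore realize
`ε T`, and the trace recovers `p = dim W`.

Conversely, two independent null 1-forms span a timelike direction, so a form of causal type falls
under the same computation, apart from a null 1-form, which would force `f = 0`. -/

lemma sgn_mul_self (i : Fin N) : sgn i * sgn i = 1 := by
  unfold sgn; split_ifs <;> norm_num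

/-! ### Orthonormal frames and independence of the frame. -/

section Frame

variable {g : LinearMap.BilinForm ℝ V} {e e' : Basis (Fin N) ℝ V}

lemma IsOrthonormalFrame.apply_left (he : IsOrthonormalFrame g e) (x : V) (i : Fin N) :
    g x (e i) = e.repr x i * sgn i := by
  conv_lhs => rw [← e.sum_repr x]
  simp only [map_sum, LinearMap.sum_apply, map_smul, LinearMap.smul_apply, smul_eq_mul, he _ _,
    mul_ite, mul_zero, Finset.sum_ite_eq', Finset.mem_univ, if_true]

lemma IsOrthonormalFrame.expand (he : IsOrthonormalFrame g e) (x : V) :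
    ∑ i, (sgn i * g x (e i)) • e i = x := by
  conv_rhs => rw [← e.sum_repr x]
  refine Finset.sum_congr rfl fun i _ => ?_
  rw [he.apply_left, mul_comm (sgn i), mul_assoc, sgn_mul_self, mul_one]

lemma IsOrthonormalFrame.symm (he : IsOrthonormalFrame g e) (x y : V) : g x y = g y x := by
  have : g = g.flip := by
    refine e.ext fun i => e.ext fun j => ?_
    change g (e i) (e j) = g (e j) (e i)
    rw [he, he]
    by_cases h : i = j
    · simp [h]
    · simp [h, Ne.symm h]
  conv_lhs => rw [this]
  rfl

lemma IsOrthonormalFrame.sum_mul (he : IsOrthonormalFrame g e) (x y : V) :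
    ∑ i, sgn i * g x (e i) * g y (e i) = g x y := by
  conv_rhs => rw [← he.expand x]
  simp [he.symm _ y]

lemma IsOrthonormalFrame.eq_zero (he : IsOrthonormalFrame g e) {x : V}
    (h : ∀ y, g x y = 0) : x = 0 := by
  rw [← he.expand x]; simp [h]

/-- The vector obtained from a 1-form by raising the index. -/
noncomputable def sharp (e : Basis (Fin N) ℝ V) : Dual ℝ V →ₗ[ℝ] V where
  toFun α := ∑ i, (sgn i * α (e i)) • e i
  map_add' α β := by simp [mul_add, add_smul, Finset.sum_add_distrib]
  map_smul' c α := by simp [Finset.smul_sum, smul_smul, mul_left_comm]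

lemma IsOrthonormalFrame.sharp_apply (he : IsOrthonormalFrame g e) (α : Dual ℝ V) (v : V) :
    g (sharp e α) v = α v := by
  conv_rhs => rw [← he.expand v]
  simp only [sharp, LinearMap.coe_mk, AddHom.coe_mk, map_sum, map_smul, LinearMap.sum_apply,
    LinearMap.smul_apply, smul_eq_mul]
  refine Finset.sum_congr rfl fun i _ => ?_
  rw [he.symm v]; ring

lemma IsOrthonormalFrame.sharp_dot (he : IsOrthonormalFrame g e) (α β : Dual ℝ V) :
    g (sharp e α) (sharp e β) = dot e α β := by
  rw [← he.sum_mul, dot]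
  simp [he.sharp_apply]

lemma IsOrthonormalFrame.sharp_injective (he : IsOrthonormalFrame g e) :
    Function.Injective (sharp e) := by
  intro α β h
  ext v
  rw [← he.sharp_apply α, h, he.sharp_apply]

/-- Orthogonality relation for the matrix of a change of orthonormal frame. -/
lemma IsOrthonormalFrame.sum_change (he : IsOrthonormalFrame g e) (he' : IsOrthonormalFrame g e')
    (j k : Fin N) :
    ∑ i, sgn i * (sgn j * g (e' i) (e j)) * (sgn k * g (e' i) (e k)) =
      if j = k then sgn j else 0 := by
  have h := he'.sum_mul (e j) (e k)
  rw [he] at h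
  have : ∑ i, sgn i * (sgn j * g (e' i) (e j)) * (sgn k * g (e' i) (e k)) =
      sgn j * sgn k * ∑ i, sgn i * g (e j) (e' i) * g (e k) (e' i) := by
    rw [Finset.mul_sum]
    refine Finset.sum_congr rfl fun i _ => ?_
    rw [he.symm (e' i), he.symm (e' i)]; ring
  rw [this, h]
  split_ifs with hjk
  · subst hjk; rw [sgn_mul_self, one_mul]
  · simp

/-- The contraction of two multilinear maps does not depend on the orthonormal frame. -/
lemma contract_eq (he : IsOrthonormalFrame g e) (he' : IsOrthonormalFrame g e')
    {M : Type*} [AddCommGroup M] [Module ℝ M] {q : ℕ}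
    (F : MultilinearMap ℝ (fun _ : Fin q => V) ℝ) (G : MultilinearMap ℝ (fun _ : Fin q => V) M) :
    ∑ I : Fin q → Fin N, ((∏ k, sgn (I k)) * F (fun k => e' (I k))) • G (fun k => e' (I k)) =
      ∑ I : Fin q → Fin N, ((∏ k, sgn (I k)) * F (fun k => e (I k))) • G (fun k => e (I k)) := by
  set a : Fin N → Fin N → ℝ := fun i j => sgn j * g (e' i) (e j) with ha
  have hex : ∀ I : Fin q → Fin N, (fun k => e' (I k)) = fun k => ∑ j, a (I k) j • e j :=
    fun I => funext fun k => (he.expand (e' (I k))).symm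
  have hF : ∀ I : Fin q → Fin N, F (fun k => e' (I k)) =
      ∑ J : Fin q → Fin N, (∏ k, a (I k) (J k)) * F (fun k => e (J k)) := by
    intro I
    rw [hex, MultilinearMap.map_sum]
    refine Finset.sum_congr rfl fun J _ => ?_
    rw [MultilinearMap.map_smul_univ, smul_eq_mul]
  have hG : ∀ I : Fin q → Fin N, G (fun k => e' (I k)) =
      ∑ J : Fin q → Fin N, (∏ k, a (I k) (J k)) • G (fun k => e (J k)) := by
    intro I
    rw [hex, MultilinearMap.map_sum]
    refine Finset.sum_congr rfl fun J _ => ?_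
    rw [MultilinearMap.map_smul_univ]
  have hprod : ∀ J K : Fin q → Fin N,
      ∑ I : Fin q → Fin N, ∏ k, (sgn (I k) * a (I k) (J k) * a (I k) (K k)) =
        if J = K then ∏ k, sgn (J k) else 0 := by
    intro J K
    -- The sum over multi-indices factors into one orthogonality relation per slot.
    rw [← Fintype.prod_sum (fun k i => sgn i * a i (J k) * a i (K k))]
    simp only [ha, he.sum_change he']
    split_ifs with h
    · subst h; simp
    · obtain ⟨k, hk⟩ := Function.ne_iff.mp h
      exact Finset.prod_eq_zero (Finset.mem_univ k) (by simp [hk])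
  calc _ = ∑ I : Fin q → Fin N, ∑ J : Fin q → Fin N, ∑ K : Fin q → Fin N,
        (∏ k, (sgn (I k) * a (I k) (J k) * a (I k) (K k))) •
          F (fun k => e (J k)) • G (fun k => e (K k)) := by
        refine Finset.sum_congr rfl fun I _ => ?_
        rw [hF, hG, Finset.mul_sum, Finset.sum_smul]
        refine Finset.sum_congr rfl fun J _ => ?_
        rw [Finset.smul_sum]
        refine Finset.sum_congr rfl fun K _ => ?_
        rw [smul_smul, smul_smul]
        simp only [Finset.prod_mul_distrib]
        generalize (∏ k, sgn (I k)) = x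
        generalize (∏ k, a (I k) (J k)) = y
        generalize (∏ k, a (I k) (K k)) = z
        congr 1; ring
    _ = ∑ J : Fin q → Fin N, ∑ K : Fin q → Fin N,
        (∑ I : Fin q → Fin N, ∏ k, (sgn (I k) * a (I k) (J k) * a (I k) (K k))) •
          F (fun k => e (J k)) • G (fun k => e (K k)) := by
        rw [Finset.sum_comm]
        refine Finset.sum_congr rfl fun J _ => ?_
        rw [Finset.sum_comm]
        simp only [Finset.sum_smul]
    _ = _ := by
        refine Finset.sum_congr rfl fun J _ => ?_
        simp only [hprod, ite_smul, zero_smul, Finset.sum_ite_eq, Finset.mem_univ, if_true]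
        rw [smul_smul]

lemma metricTrace_eq (he : IsOrthonormalFrame g e) (he' : IsOrthonormalFrame g e')
    (B : LinearMap.BilinForm ℝ V) : metricTrace e' B = metricTrace e B := by
  unfold metricTrace
  have hB : ∀ i, B (e' i) (e' i) = ∑ j, ∑ k, (sgn j * g (e' i) (e j)) *
      (sgn k * g (e' i) (e k)) * B (e j) (e k) := by
    intro i
    conv_lhs => rw [← he.expand (e' i)]
    simp only [map_sum, LinearMap.sum_apply, map_smul, LinearMap.smul_apply, smul_eq_mul,
      Finset.mul_sum]
    rw [Finset.sum_comm]
    refine Finset.sum_congr rfl fun j _ => Finset.sum_congr rfl fun k _ => ?_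
    ring
  calc _ = ∑ j, ∑ k, (∑ i, sgn i * (sgn j * g (e' i) (e j)) * (sgn k * g (e' i) (e k))) *
        B (e j) (e k) := by
        simp only [hB, Finset.mul_sum, Finset.sum_mul]
        rw [Finset.sum_comm]
        refine Finset.sum_congr rfl fun j _ => ?_
        rw [Finset.sum_comm]
        refine Finset.sum_congr rfl fun k _ => Finset.sum_congr rfl fun i _ => ?_
        ring
    _ = _ := by simp [he.sum_change he']

/-- For fixed `u`, `v` the product is the trace of the bilinear form `T u ⊗ T v`. -/
lemma cross_eq (he : IsOrthonormalFrame g e) (he' : IsOrthonormalFrame g e')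
    (T : LinearMap.BilinForm ℝ V) (u v : V) : cross e' T T u v = cross e T T u v :=
  metricTrace_eq he he' (LinearMap.BilinForm.linMulLin (T u) (T v)) |> fun h => by
    simpa [metricTrace, cross, mul_assoc] using h

lemma dot_eq (he : IsOrthonormalFrame g e) (he' : IsOrthonormalFrame g e')
    (α β : Dual ℝ V) : dot e' α β = dot e α β := by
  simpa [metricTrace, dot, mul_assoc] using
    metricTrace_eq he he' (LinearMap.BilinForm.linMulLin α β)

/-- The matrix `A` of the change of frame satisfies `A D Aᵀ = D` with `D` diagonal and invertible;
take determinants. -/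
lemma det_frame_sq (he : IsOrthonormalFrame g e) (he' : IsOrthonormalFrame g e') :
    e.det e' ^ 2 = 1 := by
  set A : Matrix (Fin N) (Fin N) ℝ := e.toMatrix e' with hA
  have hrel : A * Matrix.diagonal sgn * A.transpose = Matrix.diagonal sgn := by
    ext j k
    rw [Matrix.mul_apply, Matrix.diagonal_apply, ← he.sum_change he' j k]
    refine Finset.sum_congr rfl fun i _ => ?_
    have h : ∀ j, A j i = sgn j * g (e' i) (e j) := fun j => by
      rw [he.apply_left, hA, Basis.toMatrix_apply, mul_comm (sgn j), mul_assoc, sgn_mul_self,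
        mul_one]
    rw [Matrix.mul_diagonal, Matrix.transpose_apply, h, h]; ring
  have hd := congrArg Matrix.det hrel
  rw [Matrix.det_mul, Matrix.det_mul, Matrix.det_transpose] at hd
  have hne : (Matrix.diagonal (sgn (N := N))).det ≠ 0 := by
    rw [Matrix.det_diagonal]
    refine Finset.prod_ne_zero_iff.mpr fun i _ h => ?_
    have := sgn_mul_self i
    simp [h] at this
  rw [Basis.det_apply]
  apply mul_right_cancel₀ hne
  linear_combination hd

/-! ### Causal geometry and adapted frames. -/

/-- A vector orthogonal to a timelike vector and not spacelike vanishes. -/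
lemma IsOrthonormalFrame.eq_zero_of_orthogonal (he : IsOrthonormalFrame g e) {u x : V}
    (hu : 0 < g u u) (hxu : g x u = 0) (hx : 0 ≤ g x x) : x = 0 := by
  cases N with
  | zero =>
    rw [← he.expand x]; simp
  | succ n =>
    have key := fun a b => he.sum_mul a b
    have hs : ∀ i : Fin n, sgn (i.succ) = -1 := fun i => by simp [sgn]
    have h0 : sgn (0 : Fin (n + 1)) = 1 := by simp [sgn]
    simp only [Fin.sum_univ_succ, hs, h0, neg_mul, one_mul, Finset.sum_neg_distrib] at key
    -- Cauchy-Schwarz on the spatial components: orthogonality gives `x₀² u₀² ≤ X U`, while `X ≤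
    -- x₀²` and `U < u₀²`, which forces `x₀ = 0` and then `X = 0`.
    have hCS := Finset.sum_mul_sq_le_sq_mul_sq Finset.univ
      (fun i : Fin n => g x (e i.succ)) (fun i : Fin n => g u (e i.succ))
    have huu := key u u
    have hxx := key x x
    have hxu' := key x u
    simp only [← sq] at huu hxx
    rw [← huu] at hu
    rw [← hxx] at hx
    rw [hxu] at hxu'
    set U := ∑ i : Fin n, g u (e i.succ) ^ 2
    set X := ∑ i : Fin n, g x (e i.succ) ^ 2 with hX
    have hUn : 0 ≤ U := Finset.sum_nonneg fun i _ => sq_nonneg _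
    have hXn : 0 ≤ X := Finset.sum_nonneg fun i _ => sq_nonneg _
    have e1 : (g x (e 0) * g u (e 0)) ^ 2 ≤ X * U := by
      have : g x (e 0) * g u (e 0) = ∑ i : Fin n, g x (e i.succ) * g u (e i.succ) := by linarith
      rw [this]; exact hCS
    have e2 : g x (e 0) ^ 2 * (g u (e 0) ^ 2 - U) ≤ 0 := by nlinarith
    have e3 : g x (e 0) ^ 2 = 0 := by
      by_contra hne
      have : 0 < g x (e 0) ^ 2 := lt_of_le_of_ne (sq_nonneg _) (Ne.symm hne)
      nlinarith
    have e4 : X = 0 := by linarith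
    rw [hX, Finset.sum_eq_zero_iff_of_nonneg (fun i _ => sq_nonneg _)] at e4
    rw [← he.expand x]
    refine Finset.sum_eq_zero fun i _ => ?_
    have : g x (e i) = 0 := by
      refine Fin.cases ?_ (fun i => ?_) i
      · exact pow_eq_zero_iff two_ne_zero |>.mp e3
      · exact pow_eq_zero_iff two_ne_zero |>.mp (e4 i (Finset.mem_univ i))
    simp [this]

/-- Orthogonal null vectors are parallel. -/
lemma IsOrthonormalFrame.parallel_of_null (he : IsOrthonormalFrame g e) {t a b : V}
    (ht : 0 < g t t) (ha : g a a = 0) (hb : g b b = 0) (hab : g a b = 0) :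
    g b t • a = g a t • b := by
  rw [← sub_eq_zero]
  -- The combination `g b t • a - g a t • b` is null and orthogonal to `t`.
  refine he.eq_zero_of_orthogonal ht ?_ ?_
  · simp; ring
  · simp [ha, hb, hab, he.symm b a]

end Frame

/-- An orthonormal basis of a positive definite form adapted to a vector and a subspace. -/
lemma exists_basis_adapted (h : LinearMap.BilinForm ℝ V) (hs : ∀ x y, h x y = h y x)
    (hp : ∀ x, x ≠ 0 → 0 < h x x) (e : Basis (Fin N) ℝ V) (W : Submodule ℝ V) {u : V}
    (huW : u ∈ W) (hu : h u u = 1) :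
    ∃ b : Basis (Fin N) ℝ V, (∀ i j, h (b i) (b j) = if i = j then 1 else 0) ∧
      (∀ i : Fin N, (i : ℕ) = 0 → b i = u) ∧
      (∀ i : Fin N, (i : ℕ) < finrank ℝ W → b i ∈ W) ∧
      (∀ i : Fin N, finrank ℝ W ≤ (i : ℕ) → ∀ w ∈ W, h (b i) w = 0) := by
  let core : InnerProductSpace.Core ℝ V :=
    { inner := fun x y => h x y
      conj_inner_symm := fun x y => by simp [hs x y]
      re_inner_nonneg := fun x => by
        by_cases hx : x = 0
        · simp [hx]
        · exact (hp x hx).le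
      add_left := fun x y z => by simp
      smul_left := fun x y r => by simp
      definite := fun x hx => by
        by_contra hne
        exact (hp x hne).ne' hx }
  let : NormedAddCommGroup V := core.toNormedAddCommGroup
  let : InnerProductSpace ℝ V := InnerProductSpace.ofCore core.toCore
  have hin : ∀ x y : V, inner ℝ x y = h x y := fun _ _ => rfl
  have : FiniteDimensional ℝ V := e.finiteDimensional_of_finite
  have hN : finrank ℝ V = N := by simpa using finrank_eq_card_basis e
  have hu0 : u ≠ 0 := by rintro rfl; simp at hu
  have hWpos : 0 < finrank ℝ W := by
    have : Nontrivial W := ⟨⟨u, huW⟩, 0, fun hh => hu0 (congrArg Subtype.val hh)⟩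
    exact finrank_pos
  have hWN : finrank ℝ W ≤ N := hN ▸ Submodule.finrank_le W
  have hnu : ‖u‖ = 1 := by
    have : ‖u‖ ^ 2 = 1 := by rw [← real_inner_self_eq_norm_sq, hin, hu]
    nlinarith [norm_nonneg u]
  obtain ⟨b, hb⟩ := Orthonormal.exists_orthonormalBasis_extension_of_card_eq (𝕜 := ℝ) (E := W)
    (ι := Fin (finrank ℝ W)) (by simp) (v := fun _ => (⟨u, huW⟩ : W)) (s := {⟨0, hWpos⟩}) (by
      refine ⟨fun i => ?_, fun i j hij => absurd (Subsingleton.elim i j) hij⟩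
      simpa using hnu)
  have hbo := b.orthonormal
  obtain ⟨B, hB⟩ := Orthonormal.exists_orthonormalBasis_extension_of_card_eq (𝕜 := ℝ) (E := V)
    (ι := Fin N) (by simp [hN])
    (v := fun i => if hi : (i : ℕ) < finrank ℝ W then (b ⟨i, hi⟩ : V) else 0)
    (s := {i | (i : ℕ) < finrank ℝ W}) (by
      constructor
      · rintro ⟨i, hi⟩
        have hi' : (i : ℕ) < finrank ℝ W := hi
        simp only [Set.domRestrict_apply, hi', dif_pos]
        exact hbo.1 ⟨i, hi'⟩
      · rintro ⟨i, hi⟩ ⟨j, hj⟩ hij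
        have hi' : (i : ℕ) < finrank ℝ W := hi
        have hj' : (j : ℕ) < finrank ℝ W := hj
        have := hbo.2 (i := ⟨i, hi'⟩) (j := ⟨j, hj'⟩) (fun hh => hij (by
          have := congrArg Fin.val hh
          exact Subtype.ext (Fin.ext this)))
        simpa [hi', hj'] using this)
  have hB' : ∀ i : Fin N, ∀ hi : (i : ℕ) < finrank ℝ W, B i = b ⟨i, hi⟩ := fun i hi => by
    rw [hB i hi, dif_pos hi]
  have hBo : ∀ i j, h (B i) (B j) = if i = j then 1 else 0 :=
    fun i j => orthonormal_iff_ite.mp B.orthonormal i j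
  refine ⟨B.toBasis, by simpa using hBo, fun i hi => ?_, fun i hi => ?_, fun i hi w hw => ?_⟩
  · have : B i = b ⟨i, by omega⟩ := hB' i (by omega)
    rw [OrthonormalBasis.coe_toBasis, this]
    have h2 := hb ⟨i, by omega⟩ (by simp [hi])
    rw [h2]
  · rw [OrthonormalBasis.coe_toBasis, hB' i hi]
    exact Subtype.property _
  · rw [OrthonormalBasis.coe_toBasis]
    have := congrArg Subtype.val (b.sum_repr ⟨w, hw⟩)
    simp only [Submodule.coe_sum, Submodule.coe_smul] at this
    rw [← this, map_sum]
    refine Finset.sum_eq_zero fun j _ => ?_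
    have hj : (j : ℕ) < N := lt_of_lt_of_le j.2 hWN
    rw [map_smul, ← hB' ⟨j, hj⟩ j.2, hBo, if_neg, smul_zero]
    intro hh
    have := congrArg Fin.val hh
    have := j.2
    simp at *
    omega

/-- A subspace which contains a timelike vector has an adapted orthonormal frame. -/
lemma IsOrthonormalFrame.exists_adapted {g : LinearMap.BilinForm ℝ V} {e : Basis (Fin N) ℝ V}
    (he : IsOrthonormalFrame g e) (W : Submodule ℝ V) {u : V} (huW : u ∈ W) (hu : 0 < g u u) :
    ∃ e' : Basis (Fin N) ℝ V, IsOrthonormalFrame g e' ∧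
      (∀ i : Fin N, (i : ℕ) < finrank ℝ W → e' i ∈ W) ∧
      (∀ i : Fin N, finrank ℝ W ≤ (i : ℕ) → ∀ w ∈ W, g (e' i) w = 0) := by
  obtain ⟨u, huW, hu⟩ : ∃ u ∈ W, g u u = 1 := by
    refine ⟨(√(g u u))⁻¹ • u, W.smul_mem _ huW, ?_⟩
    simp only [map_smul, LinearMap.smul_apply, smul_eq_mul]
    have := Real.mul_self_sqrt hu.le
    have h2 := Real.sqrt_pos.mpr hu
    field_simp
    rw [sq]; linarith
  -- Reversing the sign of `g` on the complement of `u` gives a positive definite form. An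
  -- `h`-orthonormal basis starting with `u` is a `g`-orthonormal frame.
  set h : LinearMap.BilinForm ℝ V := (2 : ℝ) • LinearMap.BilinForm.linMulLin (g u) (g u) - g
    with hh
  have hval : ∀ x y, h x y = 2 * (g u x * g u y) - g x y := fun x y => by simp [hh]
  obtain ⟨b, hb, hb0, hbW, hbo⟩ := exists_basis_adapted h
    (fun x y => by rw [hval, hval, he.symm x y]; ring) (fun x hx => by
      rw [hval]
      by_contra hle
      push Not at hle
      -- If `h x x ≤ 0`, then `g x x ≥ 2 (g u x)²`, so the part of `x` orthogonal to `u` is not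
      -- spacelike.
      have hz : x - g u x • u = 0 := by
        refine he.eq_zero_of_orthogonal (u := u) (by rw [hu]; norm_num) ?_ ?_
        · simp [hu, he.symm x u]
        · simp only [map_sub, map_smul, LinearMap.sub_apply, LinearMap.smul_apply, smul_eq_mul, hu,
            he.symm x u]
          nlinarith
      have hx1 : x = g u x • u := sub_eq_zero.mp hz
      have hgxx : g x x = g u x * g u x := by
        conv_lhs => rw [hx1]
        simp [hu]
      have : g u x = 0 := by nlinarith
      rw [this, zero_smul] at hx1
      exact hx hx1) e W huW (by rw [hval, hu]; norm_num)
  have hhu : ∀ x, h x u = g u x := fun x => by rw [hval, hu, he.symm x u]; ring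
  refine ⟨b, fun i j => ?_, hbW, fun i hi w hw => ?_⟩
  · have hN : 0 < N := lt_of_le_of_lt (Nat.zero_le _) i.2
    have hu' : b ⟨0, hN⟩ = u := hb0 ⟨0, hN⟩ rfl
    have hgb : ∀ i, g u (b i) = if (i : ℕ) = 0 then 1 else 0 := fun i => by
      rw [← hhu, ← hu', hb]
      simp [Fin.ext_iff]
    have : g (b i) (b j) = 2 * (g u (b i) * g u (b j)) - h (b i) (b j) := by rw [hval]; ring
    rw [this, hb, hgb, hgb]
    unfold sgn
    by_cases hij : i = j
    · subst hij
      by_cases hi : (i : ℕ) = 0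
      · simp [hi]; norm_num
      · simp [hi]
    · have : ¬ ((i : ℕ) = 0 ∧ (j : ℕ) = 0) := fun hc => hij (Fin.ext (hc.1.trans hc.2.symm))
      by_cases hi : (i : ℕ) = 0
      · have : (j : ℕ) ≠ 0 := fun hc => this ⟨hi, hc⟩
        simp [hij, this]
      · simp [hij, hi]
  -- Since `u ∈ W`, a vector `h`-orthogonal to `W` is also `g`-orthogonal to `u`; on such a vector
  -- `h` is just `-g`.
  · have h1 := hbo i hi w hw
    have h2 := hbo i hi u huW
    rw [hhu] at h2
    rw [hval, h2] at h1
    linarith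

/-! ### Contractions, Hodge dual and superenergy of forms in a frame. -/

lemma append_update_left {X : Type*} {p m : ℕ} (a : Fin p → X) (v : Fin m → X) (i : Fin p) (z : X) :
    Fin.append (Function.update a i z) v =
      Function.update (Fin.append a v) (Fin.castAdd m i) z := by
  funext j
  refine Fin.addCases (fun j => ?_) (fun j => ?_) j
  · by_cases hj : j = i
    · subst hj; simp
    · rw [Function.update_of_ne (by simpa using hj)]
      simp [hj]
  · rw [Function.update_of_ne (by
      intro hj
      have := congrArg Fin.val hj
      simp at this
      omega)]
    simp

/-- The volume form with the last arguments inserted, as a form in the first ones. -/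
noncomputable def volumeInsertLast (e : Basis (Fin N) ℝ V) {p m : ℕ} (h : p + m = N)
    (v : Fin m → V) : V [⋀^Fin p]→ₗ[ℝ] ℝ where
  toFun a := volumeInsert e h a v
  map_update_add' := by
    intro inst a i x y
    subst h
    have : inst = instDecidableEqFin p := Subsingleton.elim _ _
    subst this
    change e.det _ = e.det _ + e.det _
    simp only [Fin.cast_eq_self, append_update_left]
    exact e.det.map_update_add _ _ _ _
  map_update_smul' := by
    intro inst a i c x
    subst h
    have : inst = instDecidableEqFin p := Subsingleton.elim _ _
    subst this
    change e.det _ = c • e.det _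
    simp only [Fin.cast_eq_self, append_update_left]
    exact e.det.map_update_smul _ _ _ _
  map_eq_zero_of_eq' := by
    intro a i j ha hij
    subst h
    refine e.det.map_eq_zero_of_eq (i := Fin.castAdd m i) (j := Fin.castAdd m j) _ ?_ ?_
    · simpa using ha
    · simpa using hij

lemma alternatingMap_sum_apply {p : ℕ} {ι : Type*} (s : Finset ι) (F : ι → V [⋀^Fin p]→ₗ[ℝ] ℝ)
    (v : Fin p → V) : (∑ i ∈ s, F i) v = ∑ i ∈ s, F i v := by
  classical
  induction s using Finset.induction_on with
  | empty => simp
  | insert a s ha ih => rw [Finset.sum_insert ha, Finset.sum_insert ha, AlternatingMap.add_apply, ih]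

section Forms

variable {g : LinearMap.BilinForm ℝ V} {e e' : Basis (Fin N) ℝ V}

lemma formDot_eq (he : IsOrthonormalFrame g e) (he' : IsOrthonormalFrame g e') {p : ℕ}
    (Ω Ω' : V [⋀^Fin p]→ₗ[ℝ] ℝ) : formDot e' Ω Ω' = formDot e Ω Ω' :=
  contract_eq he he' Ω.toMultilinearMap Ω'.toMultilinearMap

/-- Only the multi-indices that rearrange `J` contribute. There are `p!` of them, with equal
contributions because the permutation sign occurs twice. -/
lemma formDot_eq_of_support {p : ℕ} (Ω Ω' : V [⋀^Fin p]→ₗ[ℝ] ℝ) {J : Fin p → Fin N}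
    (hJ : Function.Injective J)
    (hΩ : ∀ I : Fin p → Fin N, (∃ k, I k ∉ Set.range J) → Ω (fun k => e (I k)) = 0) :
    formDot e Ω Ω' = p.factorial * ((∏ k, sgn (J k)) * Ω (fun k => e (J k)) *
      Ω' (fun k => e (J k))) := by
  have hperm : ∀ (F : V [⋀^Fin p]→ₗ[ℝ] ℝ) (σ : Equiv.Perm (Fin p)),
      F (fun k => e (J (σ k))) = ((Equiv.Perm.sign σ : ℤ) : ℝ) * F (fun k => e (J k)) := by
    intro F σ
    have := F.map_perm (fun k => e (J k)) σ
    rw [Units.smul_def, zsmul_eq_mul] at this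
    exact this
  have hsum := Finset.sum_of_injOn (s := (Finset.univ : Finset (Equiv.Perm (Fin p))))
    (t := (Finset.univ : Finset (Fin p → Fin N)))
    (f := fun _ => (∏ k, sgn (J k)) * Ω (fun k => e (J k)) * Ω' (fun k => e (J k)))
    (g := fun I => (∏ k, sgn (I k)) * Ω (fun k => e (I k)) * Ω' (fun k => e (I k)))
    (fun σ k => J (σ k)) (fun σ _ τ _ h => Equiv.ext fun k => hJ (congrFun h k))
    (fun _ _ => Finset.mem_coe.mpr (Finset.mem_univ _))
    (by
      intro I _ hI
      suffices h : Ω (fun k => e (I k)) = 0 by simp [h]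
      by_cases hr : ∃ k, I k ∉ Set.range J
      · exact hΩ I hr
      · push Not at hr
        choose τ hτ using hr
        refine Ω.map_eq_zero_of_not_injective _ fun hinj => hI ?_
        have hτi : Function.Injective τ := fun a b hab => hinj (by
          change e (I a) = e (I b)
          rw [← hτ a, ← hτ b, hab])
        exact ⟨Equiv.ofBijective τ (Finite.injective_iff_bijective.mp hτi),
          by simp, funext hτ⟩)
    (by
      intro σ _
      have hs : ((Equiv.Perm.sign σ : ℤ) : ℝ) * ((Equiv.Perm.sign σ : ℤ) : ℝ) = 1 := by
        rw [← Int.cast_mul, ← Units.val_mul, Int.units_mul_self]; simp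
      rw [hperm, hperm, Equiv.prod_comp σ (fun k => sgn (J k))]
      linear_combination (-(∏ k, sgn (J k)) * Ω (fun k => e (J k)) * Ω' (fun k => e (J k))) * hs)
  rw [formDot, ← hsum]
  simp [Fintype.card_perm]

lemma odot_eq_formDot {q : ℕ} (Ω : V [⋀^Fin (q + 1)]→ₗ[ℝ] ℝ) (u v : V) :
    odot e Ω u v = (-1 : ℝ) ^ q / (q.factorial : ℝ) *
      formDot e (Ω.curryLeft u) (Ω.curryLeft v) := rfl

lemma odot_eq (he : IsOrthonormalFrame g e) (he' : IsOrthonormalFrame g e') {p : ℕ}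
    (Ω : V [⋀^Fin p]→ₗ[ℝ] ℝ) (u v : V) : odot e' Ω u v = odot e Ω u v := by
  cases p with
  | zero => rfl
  | succ q => rw [odot_eq_formDot, odot_eq_formDot, formDot_eq he he']

lemma odot_smul {p : ℕ} (c : ℝ) (Ω : V [⋀^Fin p]→ₗ[ℝ] ℝ) (u v : V) :
    odot e (c • Ω) u v = c ^ 2 * odot e Ω u v := by
  cases p with
  | zero => simp [odot]
  | succ q =>
    simp only [odot, Finset.mul_sum, AlternatingMap.smul_apply, smul_eq_mul]
    refine Finset.sum_congr rfl fun I _ => ?_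
    ring

lemma odot_add_sub {p : ℕ} (Ω Ω' : V [⋀^Fin p]→ₗ[ℝ] ℝ) (u v : V) :
    odot e (Ω + Ω') u v + odot e (Ω - Ω') u v = 2 * odot e Ω u v + 2 * odot e Ω' u v := by
  cases p with
  | zero => simp [odot]
  | succ q =>
    simp only [odot, Finset.mul_sum, ← Finset.sum_add_distrib]
    refine Finset.sum_congr rfl fun I _ => ?_
    simp only [AlternatingMap.add_apply, AlternatingMap.sub_apply]
    ring

lemma exists_odotForm {p : ℕ} (Ω : V [⋀^Fin p]→ₗ[ℝ] ℝ) :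
    ∃ B : LinearMap.BilinForm ℝ V, ∀ u v, B u v = odot e Ω u v := by
  cases p with
  | zero => exact ⟨0, fun _ _ => rfl⟩
  | succ q =>
    let l : (Fin q → Fin N) → Dual ℝ V := fun I =>
      { toFun := fun u => Ω.curryLeft u (fun k => e (I k))
        map_add' := fun x y => by simp
        map_smul' := fun c x => by simp }
    refine ⟨((-1 : ℝ) ^ q / (q.factorial : ℝ)) • ∑ I : Fin q → Fin N, (∏ k, sgn (I k)) •
      LinearMap.BilinForm.linMulLin (l I) (l I), fun u v => ?_⟩
    simp only [odot, LinearMap.smul_apply, LinearMap.sum_apply, smul_eq_mul,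
      LinearMap.BilinForm.linMulLin_apply, mul_assoc]
    rfl

/-- The product `Ω ⊙ Ω` of a form with a single independent frame component. -/
lemma odot_of_support {q : ℕ} (Ω : V [⋀^Fin (q + 1)]→ₗ[ℝ] ℝ) {J : Fin (q + 1) → Fin N}
    (hJ : Function.Injective J)
    (hΩ : ∀ I : Fin (q + 1) → Fin N, (∃ k, I k ∉ Set.range J) → Ω (fun k => e (I k)) = 0)
    (i j : Fin N) [Decidable (i = j ∧ i ∈ Set.range J)] :
    odot e Ω (e i) (e j) = if i = j ∧ i ∈ Set.range J then
      (-1) ^ q * sgn i * (∏ k, sgn (J k)) * Ω (fun k => e (J k)) ^ 2 else 0 := by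
  have hcons : ∀ (i : Fin N) (I : Fin q → Fin N), Ω.curryLeft (e i) (fun k => e (I k)) =
      Ω (fun k => e (Fin.cons (α := fun _ => Fin N) i I k)) := by
    intro i I
    change Ω (Fin.cons (e i) fun k => e (I k)) = _
    congr 1
    funext k
    refine Fin.cases ?_ (fun k => ?_) k <;> simp
  rw [odot_eq_formDot]
  by_cases hi : i ∈ Set.range J
  · obtain ⟨a, rfl⟩ := hi
    -- Contracting with `e (J a)` leaves a form supported on `J` with its `a`-th entry deleted.
    rw [formDot_eq_of_support (e := e) (J := fun k => J (a.succAbove k)) _ _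
      (hJ.comp Fin.succAbove_right_injective)]
    · rw [hcons, hcons]
      have hfac : (q.factorial : ℝ) ≠ 0 := by exact_mod_cast q.factorial_ne_zero
      split_ifs with h
      · obtain ⟨rfl, -⟩ := h
        have hperm : Ω (fun k => e (Fin.cons (α := fun _ => Fin N) (J a) (fun k => J (a.succAbove k)) k)) ^ 2 =
            Ω (fun k => e (J k)) ^ 2 := by
          -- The cycle that moves the `a`-th entry to the front costs a sign, which the square
          -- removes.
          have h1 := Ω.map_perm (fun k => e (J k)) a.cycleRange.symm
          have h2 : (fun k => e (Fin.cons (α := fun _ => Fin N) (J a) (fun k => J (a.succAbove k)) k)) =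
              (fun k => e (J k)) ∘ a.cycleRange.symm := by
            funext k
            refine Fin.cases ?_ (fun k => ?_) k <;> simp
          rw [h2, h1]
          rcases Int.units_eq_one_or (Equiv.Perm.sign a.cycleRange.symm) with h | h <;>
            simp [h]
        rw [← hperm, Fin.prod_univ_succAbove (fun k => sgn (J k)) a]
        have hs := sgn_mul_self (J a)
        field_simp
        linear_combination (-(∏ i, sgn (J (a.succAbove i))) *
          Ω (fun k => e (Fin.cons (α := fun _ => Fin N) (J a) (fun k => J (a.succAbove k)) k)) ^ 2) * hs
      · suffices h0 : Ω (fun k => e (Fin.cons (α := fun _ => Fin N) j (fun k => J (a.succAbove k)) k)) = 0 by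
          simp [h0]
        by_cases hj : j ∈ Set.range J
        · obtain ⟨b, rfl⟩ := hj
          have hab : b ≠ a := fun hh => h ⟨by rw [hh], a, rfl⟩
          obtain ⟨c, rfl⟩ := Fin.exists_succAbove_eq hab
          exact Ω.map_eq_zero_of_eq _ (i := 0) (j := c.succ) (by simp) (Fin.succ_ne_zero c).symm
        · exact hΩ _ ⟨0, by simpa using hj⟩
    · rintro I ⟨k, hk⟩
      rw [hcons]
      by_cases hr : I k ∈ Set.range J
      · obtain ⟨b, hb⟩ := hr
        have hab : b = a := by
          by_contra hab
          obtain ⟨c, rfl⟩ := Fin.exists_succAbove_eq hab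
          exact hk ⟨c, hb⟩
        subst hab
        exact Ω.map_eq_zero_of_eq _ (i := 0) (j := k.succ) (by simp [hb]) (Fin.succ_ne_zero k).symm
      · exact hΩ _ ⟨k.succ, by simpa using hr⟩
  · rw [if_neg (fun h => hi h.2)]
    have h0 : ∀ I : Fin q → Fin N, Ω.curryLeft (e i) (fun k => e (I k)) = 0 := fun I => by
      rw [hcons]
      exact hΩ _ ⟨0, by simpa using hi⟩
    simp [formDot, h0]


/-- Written as a full contraction, the dual inherits frame invariance and the support computation
from `formDot`. -/
lemma hodgeDual_apply {p m : ℕ} (h : p + m = N) (Ω : V [⋀^Fin p]→ₗ[ℝ] ℝ) (v : Fin m → V) :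
    hodgeDual e h Ω v = 1 / (p.factorial : ℝ) * formDot e Ω (volumeInsertLast e h v) := by
  rw [hodgeDual, AlternatingMap.smul_apply, alternatingMap_sum_apply]
  rfl

lemma hodgeDual_add {p m : ℕ} (h : p + m = N) (Ω Ω' : V [⋀^Fin p]→ₗ[ℝ] ℝ) :
    hodgeDual e h (Ω + Ω') = hodgeDual e h Ω + hodgeDual e h Ω' := by
  simp only [hodgeDual, AlternatingMap.add_apply, mul_add, add_smul, Finset.sum_add_distrib,
    smul_add]

lemma hodgeDual_sub {p m : ℕ} (h : p + m = N) (Ω Ω' : V [⋀^Fin p]→ₗ[ℝ] ℝ) :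
    hodgeDual e h (Ω - Ω') = hodgeDual e h Ω - hodgeDual e h Ω' := by
  have h1 := hodgeDual_add (e := e) h (Ω - Ω') Ω'
  rw [sub_add_cancel] at h1
  rw [h1, add_sub_cancel_right]

/-- The Hodge dual is independent of the orthonormal frame up to orientation. -/
lemma hodgeDual_eq_smul (he : IsOrthonormalFrame g e) (he' : IsOrthonormalFrame g e') {p m : ℕ}
    (h : p + m = N) (Ω : V [⋀^Fin p]→ₗ[ℝ] ℝ) :
    hodgeDual e h Ω = (e.det e') • hodgeDual e' h Ω := by
  ext v
  have hvol : volumeInsertLast e h v = (e.det e') • volumeInsertLast e' h v := by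
    ext a
    have := e.det.eq_smul_basis_det e'
    exact congrArg (fun F : V [⋀^Fin N]→ₗ[ℝ] ℝ => F fun i => Fin.append a v (Fin.cast h.symm i)) this
  rw [hodgeDual_apply, hvol, ← formDot_eq he he', AlternatingMap.smul_apply, hodgeDual_apply]
  simp only [formDot, AlternatingMap.smul_apply, smul_eq_mul, Finset.mul_sum]
  refine Finset.sum_congr rfl fun I _ => ?_
  ring

/-- The frame enters the dual only through the orientation sign, and the tensor is quadratic in the
dual. -/
lemma superenergy_eq (he : IsOrthonormalFrame g e) (he' : IsOrthonormalFrame g e') {p : ℕ}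
    (Ω : V [⋀^Fin p]→ₗ[ℝ] ℝ) (u v : V) : superenergy g e' Ω u v = superenergy g e Ω u v := by
  unfold superenergy
  split_ifs with h1 h2
  · rw [hodgeDual_eq_smul he he', odot_smul, det_frame_sq he he', one_mul, odot_eq he he',
      odot_eq he he']
  · subst h2
    have h := Ω.eq_smul_basis_det e
    have : Ω (fun i => e' (Fin.cast rfl i)) = Ω (fun i => e (Fin.cast rfl i)) * e.det e' :=
      congrArg (fun F : V [⋀^Fin p]→ₗ[ℝ] ℝ => F e') h
    rw [this, mul_pow, det_frame_sq he he', mul_one]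
  · rfl

lemma exists_superenergyForm (g : LinearMap.BilinForm ℝ V) (e : Basis (Fin N) ℝ V) {p : ℕ}
    (Ω : V [⋀^Fin p]→ₗ[ℝ] ℝ) :
    ∃ B : LinearMap.BilinForm ℝ V, ∀ u v, B u v = superenergy g e Ω u v := by
  unfold superenergy
  split_ifs with h1 h2
  · obtain ⟨B, hB⟩ := exists_odotForm (e := e) Ω
    obtain ⟨C, hC⟩ := exists_odotForm (e := e) (hodgeDual e (Nat.add_sub_of_le h1.le) Ω)
    exact ⟨(1 / 2 : ℝ) • (B + C), fun u v => by simp [hB, hC, mul_add]⟩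
  · exact ⟨(1 / 2 * (Ω fun i => e (Fin.cast h2 i)) ^ 2) • g, fun u v => by simp⟩
  · exact ⟨0, fun _ _ => rfl⟩

lemma eq_superenergy_of_basis {B : LinearMap.BilinForm ℝ V} {p : ℕ} {Ω : V [⋀^Fin p]→ₗ[ℝ] ℝ}
    (b : Basis (Fin N) ℝ V) (h : ∀ i j, B (b i) (b j) = superenergy g e Ω (b i) (b j)) (u v : V) :
    B u v = superenergy g e Ω u v := by
  obtain ⟨C, hC⟩ := exists_superenergyForm g e Ω
  have : B = C := b.ext fun i => b.ext fun j => by rw [h, hC]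
  rw [this, hC]

/-- The parallelogram law for a quadratic expression; it carries identities from timelike 1-forms to
all 1-forms. -/
lemma superenergy_add_sub {p : ℕ} (hp : p < N) (Ω Ω' : V [⋀^Fin p]→ₗ[ℝ] ℝ) (u v : V) :
    superenergy g e (Ω + Ω') u v + superenergy g e (Ω - Ω') u v =
      2 * superenergy g e Ω u v + 2 * superenergy g e Ω' u v := by
  simp only [superenergy, dif_pos hp, hodgeDual_add, hodgeDual_sub]
  linear_combination (1 / 2) * odot_add_sub (e := e) Ω Ω' u v + (1 / 2) *
    odot_add_sub (e := e) (hodgeDual e (Nat.add_sub_of_le hp.le) Ω)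
      (hodgeDual e (Nat.add_sub_of_le hp.le) Ω') u v

lemma prod_sgn_sq {q : ℕ} (I : Fin q → Fin N) : (∏ k, sgn (I k)) ^ 2 = 1 := by
  rw [sq, ← Finset.prod_mul_distrib]
  simp [sgn_mul_self]

/-- The product `*Ω ⊙ *Ω` for a form `Ω` along the first `p` frame vectors. -/
lemma odot_hodgeDual_of_support {p m : ℕ} (h : p + m = N) (hp : 1 ≤ p) (hm : 1 ≤ m)
    (Ω : V [⋀^Fin p]→ₗ[ℝ] ℝ)
    (hΩ : ∀ I : Fin p → Fin N, (∃ k, p ≤ (I k : ℕ)) → Ω (fun k => e (I k)) = 0) (i j : Fin N) :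
    odot e (hodgeDual e h Ω) (e i) (e j) = if i = j ∧ p ≤ (i : ℕ) then
      Ω (fun k => e (Fin.castLE (by omega) k)) ^ 2 else 0 := by
  subst h
  set J₀ : Fin p → Fin (p + m) := Fin.castAdd m with hJ₀
  have hr : ∀ i : Fin (p + m), i ∉ Set.range J₀ → p ≤ (i : ℕ) := fun i hi => by
    by_contra hlt
    push Not at hlt
    exact hi ⟨⟨i, hlt⟩, rfl⟩
  have hdual : ∀ v, hodgeDual e rfl Ω v = (∏ k, sgn (J₀ k)) * Ω (fun k => e (J₀ k)) *
      e.det (Fin.append (fun k => e (J₀ k)) v) := by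
    intro v
    rw [hodgeDual_apply, formDot_eq_of_support (e := e) (J := J₀) Ω _
      (Fin.castAdd_injective p m) (fun I ⟨k, hk⟩ => hΩ I ⟨k, hr _ hk⟩)]
    have hfac : (p.factorial : ℝ) ≠ 0 := by exact_mod_cast p.factorial_ne_zero
    field_simp
    rfl
  obtain ⟨q, rfl⟩ : ∃ q, m = q + 1 := ⟨m - 1, by omega⟩
  set J₁ : Fin (q + 1) → Fin (p + (q + 1)) := Fin.natAdd p with hJ₁
  have hr₁ : ∀ i : Fin (p + (q + 1)), i ∈ Set.range J₁ ↔ p ≤ (i : ℕ) := fun i => by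
    constructor
    · rintro ⟨k, rfl⟩; simp [hJ₁]
    · intro hi
      exact ⟨⟨i - p, by omega⟩, Fin.ext (by simp [hJ₁]; omega)⟩
  have hs : ∀ i : Fin (p + (q + 1)), p ≤ (i : ℕ) → sgn i = -1 := fun i hi => by
    unfold sgn; rw [if_neg (by omega)]
  classical
  rw [odot_of_support (e := e) (J := J₁) _ (Fin.natAdd_injective (q + 1) p)]
  · simp only [hr₁]
    split_ifs with hij
    -- The last `m = q + 1` frame vectors are all spacelike, so `(-1)^q`, `sgn i = -1` and
    -- `(-1)^(q+1)` multiply to `1`.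
    · have hprod : ∏ k, sgn (J₁ k) = (-1) ^ (q + 1) := by
        rw [Finset.prod_congr rfl fun k _ => hs (J₁ k) (by simp [hJ₁])]
        simp
      have hdet : e.det (Fin.append (fun k => e (J₀ k)) fun k => e (J₁ k)) = 1 := by
        rw [← e.det_self]
        congr 1
        funext k
        refine Fin.addCases (fun k => ?_) (fun k => ?_) k <;> simp [hJ₀, hJ₁]
      have hq : ((-1 : ℝ) ^ q) ^ 2 = 1 := by rw [← pow_mul, mul_comm, pow_mul]; simp
      have hcast : (fun k : Fin p => e (Fin.castLE (by omega) k)) = fun k => e (J₀ k) := rfl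
      rw [hprod, hs i hij.2, hdual, hdet, mul_one, mul_pow, prod_sgn_sq, one_mul, hcast]
      rw [pow_succ]
      linear_combination (Ω fun k => e (J₀ k)) ^ 2 * hq
    · rfl
  · rintro I ⟨k, hk⟩
    rw [hr₁, not_le] at hk
    rw [hdual, e.det.map_eq_zero_of_eq _ (i := Fin.castAdd _ ⟨I k, hk⟩) (j := Fin.natAdd p k),
      mul_zero]
    · have : I k = Fin.castAdd (q + 1) ⟨I k, hk⟩ := rfl
      rw [Fin.append_left, Fin.append_right]
      exact congrArg e this.symm
    · intro hh
      have := congrArg Fin.val hh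
      simp at this
      omega

/-- The product `Ω ⊙ Ω` of a form along the first `p` frame vectors. -/
lemma odot_of_support_first {p : ℕ} (hp : 1 ≤ p) (hpN : p ≤ N) (Ω : V [⋀^Fin p]→ₗ[ℝ] ℝ)
    (hΩ : ∀ I : Fin p → Fin N, (∃ k, p ≤ (I k : ℕ)) → Ω (fun k => e (I k)) = 0) (i j : Fin N) :
    odot e Ω (e i) (e j) = if i = j ∧ (i : ℕ) < p then
      sgn i * Ω (fun k => e (Fin.castLE hpN k)) ^ 2 else 0 := by
  obtain ⟨q, rfl⟩ : ∃ q, p = q + 1 := ⟨p - 1, by omega⟩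
  have hr : ∀ i : Fin N, i ∈ Set.range (Fin.castLE hpN) ↔ (i : ℕ) < q + 1 := fun i =>
    ⟨by rintro ⟨k, rfl⟩; exact k.2, fun h => ⟨⟨i, h⟩, rfl⟩⟩
  -- One timelike and `q` spacelike vectors: this sign cancels the prefactor in `odot`.
  have hprod : ∏ k : Fin (q + 1), sgn (Fin.castLE hpN k) = (-1) ^ q := by
    rw [Fin.prod_univ_succ]
    simp [sgn]
  have hq : ((-1 : ℝ) ^ q) ^ 2 = 1 := by rw [← pow_mul, mul_comm, pow_mul]; simp
  classical
  rw [odot_of_support (e := e) (J := Fin.castLE hpN) Ω (Fin.castLE_injective hpN)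
    (fun I ⟨k, hk⟩ => hΩ I ⟨k, by rwa [hr, not_lt] at hk⟩), hprod]
  simp only [hr]
  split_ifs with hij
  · linear_combination (sgn i * Ω (fun k => e (Fin.castLE hpN k)) ^ 2) * hq
  · rfl

/-- The superenergy tensor of a form along the first `p` frame vectors. -/
lemma superenergy_of_support (he : IsOrthonormalFrame g e) {p : ℕ} (hp : 1 ≤ p) (hpN : p ≤ N)
    (Ω : V [⋀^Fin p]→ₗ[ℝ] ℝ)
    (hΩ : ∀ I : Fin p → Fin N, (∃ k, p ≤ (I k : ℕ)) → Ω (fun k => e (I k)) = 0) (i j : Fin N) :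
    superenergy g e Ω (e i) (e j) = 1 / 2 * Ω (fun k => e (Fin.castLE hpN k)) ^ 2 *
      (if (i : ℕ) < p then 1 else -1) * g (e i) (e j) := by
  unfold superenergy
  rcases hpN.lt_or_eq with h | h
  · rw [dif_pos h, odot_of_support_first hp hpN Ω hΩ,
      odot_hodgeDual_of_support (Nat.add_sub_of_le h.le) hp (by omega) Ω hΩ, he]
    by_cases hij : i = j
    · subst hij
      by_cases hi : (i : ℕ) < p
      · simp only [hi, true_and, if_true, not_le.mpr hi, if_false]
        ring
      · have hs : sgn i = -1 := by unfold sgn; rw [if_neg (by omega)]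
        simp only [hi, true_and, if_true, not_lt.mp hi, if_false, hs]
        ring
    · simp [hij]
  · subst h
    rw [dif_neg (lt_irrefl _), dif_pos rfl, if_pos i.2, mul_one]
    rfl

end Forms

/-! ### Superenergy of simple forms and of 1-forms. -/

section Simple

variable {g : LinearMap.BilinForm ℝ V} {e e' : Basis (Fin N) ℝ V}

lemma wedge_apply {p : ℕ} (ω : Fin p → Dual ℝ V) (v : Fin p → V) :
    wedge ω v = Matrix.det (Matrix.of fun k j => ω j (v k)) := rfl

lemma wedge_eq_zero {p : ℕ} (ω : Fin p → Dual ℝ V) (v : Fin p → V) (k : Fin p)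
    (h : ∀ j, ω j (v k) = 0) : wedge ω v = 0 := by
  rw [wedge_apply]
  exact Matrix.det_eq_zero_of_row_eq_zero k h

/-- The superenergy tensor of a simple form in a frame adapted to it. -/
lemma superenergy_wedge (he : IsOrthonormalFrame g e) (he' : IsOrthonormalFrame g e') {p : ℕ}
    (hp : 1 ≤ p) (hpN : p ≤ N) (ω : Fin p → Dual ℝ V)
    (hω : ∀ i : Fin N, p ≤ (i : ℕ) → ∀ j, ω j (e' i) = 0) (i j : Fin N) :
    superenergy g e (wedge ω) (e' i) (e' j) =
      1 / 2 * wedge ω (fun k => e' (Fin.castLE hpN k)) ^ 2 *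
        (if (i : ℕ) < p then 1 else -1) * g (e' i) (e' j) := by
  rw [← superenergy_eq he he', superenergy_of_support he' hp hpN]
  rintro I ⟨k, hk⟩
  exact wedge_eq_zero ω _ k (hω _ hk)

/-- The raised 1-forms span a `p`-dimensional subspace; frame vectors orthogonal to it are
annihilated by every `ω j`. -/
lemma IsOrthonormalFrame.exists_adapted_forms (he : IsOrthonormalFrame g e) {p : ℕ}
    {ω : Fin p → Dual ℝ V} (hω : LinearIndependent ℝ ω) {u : V}
    (huW : u ∈ Submodule.span ℝ (Set.range fun j => sharp e (ω j))) (hu : 0 < g u u) :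
    ∃ e' : Basis (Fin N) ℝ V, IsOrthonormalFrame g e' ∧
      ∀ i : Fin N, p ≤ (i : ℕ) → ∀ j, ω j (e' i) = 0 := by
  obtain ⟨e', he', -, h⟩ := he.exists_adapted _ huW hu
  have hli : LinearIndependent ℝ (fun j => sharp e (ω j)) :=
    hω.map' (sharp e) (LinearMap.ker_eq_bot.mpr he.sharp_injective)
  rw [finrank_span_eq_card hli, Fintype.card_fin] at h
  refine ⟨e', he', fun i hi j => ?_⟩
  rw [← he.sharp_apply, he.symm]
  exact h i hi _ (Submodule.subset_span ⟨j, rfl⟩)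

lemma dot_add_add (α β : Dual ℝ V) :
    dot e (α + β) (α + β) = dot e α α + 2 * dot e α β + dot e β β := by
  simp only [dot, Finset.mul_sum, ← Finset.sum_add_distrib, LinearMap.add_apply]
  exact Finset.sum_congr rfl fun i _ => by ring

lemma dot_sub_sub (α β : Dual ℝ V) :
    dot e (α - β) (α - β) = dot e α α - 2 * dot e α β + dot e β β := by
  simp only [dot, Finset.mul_sum, ← Finset.sum_add_distrib, ← Finset.sum_sub_distrib,
    LinearMap.sub_apply]
  exact Finset.sum_congr rfl fun i _ => by ring

lemma dot_smul_smul (c d : ℝ) (α β : Dual ℝ V) : dot e (c • α) (d • β) = c * d * dot e α β := by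
  simp only [dot, Finset.mul_sum, LinearMap.smul_apply, smul_eq_mul]
  exact Finset.sum_congr rfl fun i _ => by ring

lemma dot_coord (α : Dual ℝ V) (i : Fin N) : dot e α (e.coord i) = sgn i * α (e i) := by
  simp [dot, Finsupp.single_apply]

lemma wedge_add_one (α β : Dual ℝ V) :
    wedge (fun _ : Fin 1 => α + β) = wedge (fun _ : Fin 1 => α) + wedge (fun _ : Fin 1 => β) := by
  ext v; simp [wedge_apply]

lemma wedge_sub_one (α β : Dual ℝ V) :
    wedge (fun _ : Fin 1 => α - β) = wedge (fun _ : Fin 1 => α) - wedge (fun _ : Fin 1 => β) := by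
  ext v; simp [wedge_apply]

lemma superenergy_oneForm_of_timelike (he : IsOrthonormalFrame g e) (hN : 1 ≤ N) (k : Dual ℝ V)
    (hk : 0 < dot e k k) (u v : V) :
    superenergy g e (wedge fun _ : Fin 1 => k) u v = k u * k v - 1 / 2 * dot e k k * g u v := by
  have hk0 : k ≠ 0 := by
    rintro rfl
    simp [dot] at hk
  have hli : LinearIndependent ℝ (fun _ : Fin 1 => k) :=
    LinearIndependent.of_subsingleton 0 hk0
  obtain ⟨e', he', h'⟩ := he.exists_adapted_forms hli (u := sharp e k)
    (Submodule.subset_span ⟨0, rfl⟩) (by rwa [he.sharp_dot])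
  have hki : ∀ i : Fin N, (i : ℕ) ≠ 0 → k (e' i) = 0 := fun i hi => h' i (by omega) 0
  have hdot : dot e k k = k (e' ⟨0, hN⟩) ^ 2 := by
    rw [← dot_eq he he', dot, Finset.sum_eq_single ⟨0, hN⟩]
    · simp [sgn, sq]
    · intro i _ hi
      rw [hki i (fun h => hi (Fin.ext h)), mul_zero]
    · simp
  have key := eq_superenergy_of_basis (g := g) (e := e) (Ω := wedge fun _ : Fin 1 => k)
    (B := LinearMap.BilinForm.linMulLin k k - (1 / 2 * dot e k k) • g) e' (fun i j => by
      rw [superenergy_wedge he he' le_rfl hN _ h' i j, hdot]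
      have hw : wedge (fun _ : Fin 1 => k) (fun l => e' (Fin.castLE hN l)) = k (e' ⟨0, hN⟩) := by
        simp only [wedge_apply, Matrix.det_unique, Matrix.of_apply]
        rfl
      rw [hw]
      simp only [LinearMap.sub_apply, LinearMap.smul_apply, LinearMap.BilinForm.linMulLin_apply,
        smul_eq_mul, he' i j]
      by_cases hi : (i : ℕ) = 0
      · obtain rfl : i = ⟨0, hN⟩ := Fin.ext hi
        by_cases hj : (j : ℕ) = 0
        · obtain rfl : j = ⟨0, hN⟩ := Fin.ext hj
          simp [sgn]; ring
        · rw [hki j hj, if_neg (fun h => hj (by rw [← h]))]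
          ring
      · rw [hki i hi, if_neg (show ¬ (i : ℕ) < 1 by omega)]
        ring) u v
  rw [← key]
  simp

/-- The superenergy tensor of a 1-form. -/
lemma superenergy_oneForm (he : IsOrthonormalFrame g e) (hN : 2 ≤ N) (k : Dual ℝ V) (u v : V) :
    superenergy g e (wedge fun _ : Fin 1 => k) u v = k u * k v - 1 / 2 * dot e k k * g u v := by
  have hN1 : 1 ≤ N := by omega
  set θ : Dual ℝ V := e.coord ⟨0, hN1⟩
  set a := k (e ⟨0, hN1⟩)
  set s := 1 + 2 * |a| + |dot e k k| with hs
  have hkθ : dot e k (s • θ) = s * a := by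
    have := dot_smul_smul (e := e) 1 s k θ
    rw [one_smul] at this
    rw [this, dot_coord]
    simp [sgn, a]
  have hθθ : dot e (s • θ) (s • θ) = s ^ 2 := by
    rw [dot_smul_smul, dot_coord]
    simp [sgn, θ, sq]
  have hs1 : 1 ≤ s := by rw [hs]; linarith [abs_nonneg a, abs_nonneg (dot e k k)]
  have hbound : |dot e k k| + 2 * (s * |a|) < s ^ 2 := by
    have : s ^ 2 = s + 2 * (s * |a|) + s * |dot e k k| := by rw [hs]; ring
    nlinarith [abs_nonneg (dot e k k)]
  have h1 : |s * a| = s * |a| := by rw [abs_mul, abs_of_pos (by linarith)]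
  have h2 := neg_abs_le (dot e k k)
  have h3 := neg_abs_le (s * a)
  have h4 := le_abs_self (s * a)
  have hadd := dot_add_add (e := e) k (s • θ)
  have hsub := dot_sub_sub (e := e) k (s • θ)
  rw [hkθ, hθθ] at hadd hsub
  have e1 := superenergy_oneForm_of_timelike he hN1 (k + s • θ) (by rw [hadd]; linarith) u v
  have e2 := superenergy_oneForm_of_timelike he hN1 (k - s • θ) (by rw [hsub]; linarith) u v
  have e3 := superenergy_oneForm_of_timelike he hN1 (s • θ) (by rw [hθθ]; positivity) u v
  have e4 := superenergy_add_sub (g := g) (e := e) (show 1 < N by omega)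
    (wedge fun _ : Fin 1 => k) (wedge fun _ : Fin 1 => s • θ) u v
  rw [← wedge_add_one, ← wedge_sub_one, e1, e2, e3, hadd, hsub, hθθ] at e4
  simp only [LinearMap.add_apply, LinearMap.sub_apply] at e4
  linear_combination (-1 / 2) * e4

end Simple

/-! ### Diagonalization for positive square, and forms of causal type. -/

section Classification

variable {g : LinearMap.BilinForm ℝ V} {e e' : Basis (Fin N) ℝ V}

lemma IsOrthonormalFrame.apply_first (he : IsOrthonormalFrame g e) (hN : 0 < N) :
    g (e ⟨0, hN⟩) (e ⟨0, hN⟩) = 1 := by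
  rw [he, if_pos rfl]; simp [sgn]

lemma metricTrace_of_diag (he : IsOrthonormalFrame g e) {T : LinearMap.BilinForm ℝ V} {c : ℝ}
    {p : ℕ} (hp : p ≤ N)
    (hT : ∀ i j, T (e i) (e j) = c * (if (i : ℕ) < p then 1 else -1) * g (e i) (e j)) :
    metricTrace e T = (2 * (p : ℝ) - N) * c := by
  have h1 : metricTrace e T = c * ∑ i : Fin N, (if (i : ℕ) < p then (1 : ℝ) else -1) := by
    rw [metricTrace, Finset.mul_sum]
    refine Finset.sum_congr rfl fun i _ => ?_
    rw [hT, he, if_pos rfl]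
    linear_combination (c * if (i : ℕ) < p then 1 else -1) * sgn_mul_self i
  obtain ⟨m, rfl⟩ := Nat.exists_eq_add_of_le hp
  rw [h1, Fin.sum_univ_add]
  simp
  ring

lemma cross_of_diag (he : IsOrthonormalFrame g e) {T : LinearMap.BilinForm ℝ V} {c : ℝ}
    {p : ℕ} (hT : ∀ i j, T (e i) (e j) = c * (if (i : ℕ) < p then 1 else -1) * g (e i) (e j))
    (u v : V) : cross e T T u v = c ^ 2 * g u v := by
  have h : ∀ x j, T x (e j) = c * (if (j : ℕ) < p then 1 else -1) * g x (e j) := by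
    intro x j
    have : T.flip (e j) = (c * (if (j : ℕ) < p then 1 else -1)) • g.flip (e j) := by
      refine e.ext fun i => ?_
      change T (e i) (e j) = _ * g (e i) (e j)
      rw [hT, he]
      split_ifs <;> simp_all
    exact congrArg (fun F : V →ₗ[ℝ] ℝ => F x) this
  rw [← he.sum_mul, cross, Finset.mul_sum]
  refine Finset.sum_congr rfl fun i _ => ?_
  rw [h, h]
  split_ifs <;> ring

lemma IsOrthonormalFrame.cross_eq_apply (he : IsOrthonormalFrame g e)
    (T : LinearMap.BilinForm ℝ V) (u v : V) :
    cross e T T u v = g (sharp e (T u)) (sharp e (T v)) :=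
  (he.sharp_dot (T u) (T v)).symm

/-- A symmetric tensor with positive square is diagonal with entries `±√f` in some frame. -/
lemma exists_frame_diag (he : IsOrthonormalFrame g e) (hN : 1 ≤ N)
    {T : LinearMap.BilinForm ℝ V} (hT : ∀ u v, T u v = T v u) {f : ℝ}
    (hTT : ∀ u v, cross e T T u v = f * g u v) (hf : 0 < f) :
    ∃ ε : ℝ, (ε = 1 ∨ ε = -1) ∧ ∃ p : ℕ, 1 ≤ p ∧ p ≤ N ∧ ∃ e' : Basis (Fin N) ℝ V,
      IsOrthonormalFrame g e' ∧ ∀ i j, (ε • T) (e' i) (e' j) =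
        √f * (if (i : ℕ) < p then 1 else -1) * g (e' i) (e' j) := by
  set A : V →ₗ[ℝ] V := sharp e ∘ₗ T with hA
  have hAg : ∀ u v, g (A u) v = T u v := fun u v => he.sharp_apply (T u) v
  have hAs : ∀ u v, g (A u) v = g u (A v) := fun u v => by rw [hAg, he.symm u, hAg, hT]
  have hAA : ∀ u, A (A u) = f • u := fun u => by
    rw [← sub_eq_zero]
    refine he.eq_zero fun v => ?_
    have h1 := he.cross_eq_apply T u v
    rw [hTT] at h1
    simp only [map_sub, map_smul, LinearMap.sub_apply, LinearMap.smul_apply, smul_eq_mul]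
    rw [hAs (A u) v, h1]
    exact sub_self _
  set r := √f with hr
  have hr0 : 0 < r := Real.sqrt_pos.mpr hf
  have hrr : r * r = f := Real.mul_self_sqrt hf.le
  -- From `A² = r²`, the vectors `r u ± A u` satisfy the eigenvalue equation for `±r` and have
  -- squares `2f ± 2r g(u, A u)`. The sign of `g u (A u)` decides which is surely timelike, and so
  -- decides `ε`.
  obtain ⟨ε, hε, x, hAx, hx⟩ : ∃ ε : ℝ, (ε = 1 ∨ ε = -1) ∧ ∃ x, A x = (ε * r) • x ∧
      0 < g x x := by
    set u := e ⟨0, hN⟩ with hu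
    have huu : g u u = 1 := he.apply_first hN
    have hAuu : g (A u) (A u) = f := by
      rw [hAs, hAA]; simp [huu]
    have hval : ∀ ε : ℝ, ε * ε = 1 →
        g (r • u + ε • A u) (r • u + ε • A u) = 2 * f + 2 * r * ε * g u (A u) := fun ε hε => by
      simp only [map_add, map_smul, LinearMap.add_apply, LinearMap.smul_apply, smul_eq_mul, huu,
        hAuu, he.symm (A u) u]
      linear_combination hrr + f * hε
    have heig : ∀ ε : ℝ, ε * ε = 1 → A (r • u + ε • A u) = (ε * r) • (r • u + ε • A u) :=
      fun ε hε => by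
        rw [map_add, map_smul, map_smul, hAA, smul_add, smul_smul, smul_smul, smul_smul,
          add_comm]
        congr 2
        · rw [← hrr]; ring
        · linear_combination (-r) * hε
    rcases le_total 0 (g u (A u)) with h | h
    · refine ⟨1, Or.inl rfl, _, heig 1 (by norm_num), ?_⟩
      rw [hval 1 (by norm_num)]
      have := mul_nonneg hr0.le h
      linarith
    · refine ⟨-1, Or.inr rfl, _, heig (-1) (by norm_num), ?_⟩
      rw [hval (-1) (by norm_num)]
      have := mul_nonneg hr0.le (neg_nonneg.mpr h)
      linarith
  have hεε : ε * ε = 1 := by rcases hε with rfl | rfl <;> norm_num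
  set W : Submodule ℝ V := LinearMap.ker (A - (ε * r) • LinearMap.id) with hW
  have hmem : ∀ y, y ∈ W ↔ A y = (ε * r) • y := fun y => by
    rw [hW, LinearMap.mem_ker]; simp [sub_eq_zero]
  obtain ⟨e', he', heW, heo⟩ := he.exists_adapted W ((hmem x).mpr hAx) hx
  have : FiniteDimensional ℝ V := e.finiteDimensional_of_finite
  refine ⟨ε, hε, finrank ℝ W, ?_, ?_, e', he', fun i j => ?_⟩
  · have hx0 : x ≠ 0 := by rintro rfl; simp at hx
    have : Nontrivial W := ⟨⟨x, (hmem x).mpr hAx⟩, 0, fun h => hx0 (congrArg Subtype.val h)⟩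
    exact finrank_pos
  · have := Submodule.finrank_le W
    rwa [finrank_eq_card_basis e, Fintype.card_fin] at this
  · rw [LinearMap.smul_apply, LinearMap.smul_apply, smul_eq_mul, ← hAg]
    split_ifs with hi
    · rw [(hmem _).mp (heW i hi)]
      simp only [map_smul, LinearMap.smul_apply, smul_eq_mul]
      linear_combination (r * g (e' i) (e' j)) * hεε
    -- The operator `A + εr` maps into `W` and is self-adjoint, so it kills everything orthogonal to
    -- `W`.
    · have hWz : ∀ y, A y + (ε * r) • y ∈ W := fun y => by
        rw [hmem, map_add, map_smul, hAA, smul_add, smul_smul, add_comm]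
        congr 2
        linear_combination (-f) * hεε - ε * ε * hrr
      have hz : A (e' i) + (ε * r) • e' i = 0 := by
        refine he.eq_zero fun v => ?_
        have := heo i (not_lt.mp hi) _ (hWz v)
        simp only [map_add, map_smul, LinearMap.add_apply, LinearMap.smul_apply] at this ⊢
        rw [hAs]; exact this
      rw [eq_neg_of_add_eq_zero_left hz]
      simp only [map_neg, map_smul, LinearMap.neg_apply, LinearMap.smul_apply, smul_eq_mul]
      linear_combination (-r * g (e' i) (e' j)) * hεε

/-- Along the first `p` vectors of a frame there are 1-forms of causal type. -/
lemma exists_causal_forms (e : Basis (Fin N) ℝ V) {p : ℕ} (hp : 1 ≤ p) (hpN : p ≤ N) :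
    ∃ ω : Fin p → Dual ℝ V, LinearIndependent ℝ ω ∧
      (∀ i : Fin N, p ≤ (i : ℕ) → ∀ j, ω j (e i) = 0) ∧
      (p = 1 → ∀ i, 0 ≤ dot e (ω i) (ω i)) ∧ (1 < p → ∀ i, IsNull e (ω i)) := by
  obtain ⟨q, rfl⟩ : ∃ q, p = q + 1 := ⟨p - 1, by omega⟩
  set θ : Fin (q + 1) → Dual ℝ V := fun j => e.coord (Fin.castLE hpN j) with hθ
  have hθe : ∀ j (i : Fin N), θ j (e i) = if (i : ℕ) = j then 1 else 0 := fun j i => by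
    simp [hθ, Finsupp.single_apply, Fin.ext_iff]
  have hdot : ∀ i j, dot e (θ i) (θ j) = if i = j then sgn (Fin.castLE hpN i) else 0 := by
    intro i j
    rw [show θ j = e.coord (Fin.castLE hpN j) from rfl, dot_coord, hθe]
    by_cases h : i = j
    · subst h; simp
    · have : (j : ℕ) ≠ i := fun hh => h (Fin.ext hh.symm)
      simp [h, this]
  have hs0 : sgn (Fin.castLE hpN 0) = 1 := by simp [sgn]
  cases q with
  | zero =>
    refine ⟨fun _ => θ 0, ?_, fun i hi j => ?_, fun _ i => ?_, fun h => absurd h (lt_irrefl _)⟩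
    · refine LinearIndependent.of_subsingleton (ι := Fin 1) 0 fun h => ?_
      have := hθe 0 (Fin.castLE hpN 0)
      rw [h] at this
      simp at this
    · rw [hθe, if_neg (by simp; omega)]
    · change 0 ≤ dot e (θ 0) (θ 0)
      rw [hdot, if_pos rfl, hs0]; norm_num
  | succ q =>
    have hs : ∀ k : Fin (q + 1), sgn (Fin.castLE hpN k.succ) = -1 := fun k => by simp [sgn]
    -- Null because `θ 0` is timelike and each `θ k.succ` is spacelike, orthogonal and of opposite
    -- square; `θ 1` is used with both signs to reach `q + 2` independent forms.
    set ω : Fin (q + 2) → Dual ℝ V := Fin.cons (θ 0 + θ 1) fun k => θ 0 - θ k.succ with hω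
    have hv : ∀ i : Fin N, q + 1 + 1 ≤ (i : ℕ) → ∀ j, ω j (e i) = 0 := by
      intro i hi j
      refine Fin.cases ?_ (fun j => ?_) j
      · simp only [hω, Fin.cons_zero, LinearMap.add_apply]
        rw [hθe, hθe, if_neg (by simp; omega), if_neg (by simp; omega), add_zero]
      · have := j.2
        simp only [hω, Fin.cons_succ, LinearMap.sub_apply, hθe]
        rw [if_neg, if_neg, sub_self]
        · simp; omega
        · simp; omega
    have hli : LinearIndependent ℝ ω := by
      rw [Fintype.linearIndependent_iff]
      intro a ha
      have hev : ∀ i : Fin N, a 0 * (θ 0 (e i) + θ 1 (e i)) +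
          ∑ k : Fin (q + 1), a k.succ * (θ 0 (e i) - θ k.succ (e i)) = 0 := by
        intro i
        have := congrArg (fun F : Dual ℝ V => F (e i)) ha
        simpa [Fin.sum_univ_succ (n := q + 1), hω, mul_add] using this
      have h0 := hev (Fin.castLE hpN 0)
      have hk := fun k : Fin (q + 1) => hev (Fin.castLE hpN k.succ)
      have h1 : ∀ k : Fin (q + 1), a k.succ = if k = 0 then a 0 else 0 := by
        intro k
        have := hk k
        simp only [hθe, Fin.val_castLE, Fin.val_succ, Fin.val_zero, Fin.val_one,
          Nat.add_right_cancel_iff, ← Fin.ext_iff, Nat.add_eq_zero_iff, one_ne_zero, and_false,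
          if_false, zero_sub, zero_add, mul_neg, mul_ite, mul_one, mul_zero,
          Finset.sum_neg_distrib, Finset.sum_ite_eq, Finset.mem_univ, if_true,
          Nat.add_eq_right, Fin.val_eq_zero_iff] at this
        linarith
      have h2 : a 0 = 0 := by
        simp [hθe, h1] at h0
        linarith
      intro i
      refine Fin.cases h2 (fun k => ?_) i
      rw [h1, h2, ite_self]
    refine ⟨ω, hli, hv, fun h => by omega, fun _ i => ⟨hli.ne_zero i, ?_⟩⟩
    refine Fin.cases ?_ (fun j => ?_) i
    · simp only [hω, Fin.cons_zero, dot_add_add, hdot]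
      have := hs 0
      rw [Fin.succ_zero_eq_one] at this
      simp [hs0, this]
    · simp only [hω, Fin.cons_succ, dot_sub_sub, hdot]
      simp [hs0, hs, (Fin.succ_ne_zero j).symm]

end Classification

/-! ### Realization by causal forms, the converse, and vanishing square. -/

section Classification

variable {g : LinearMap.BilinForm ℝ V} {e e' : Basis (Fin N) ℝ V}

/-- A kernel vector of the matrix would be a linear relation among the `ω j` on the first `p` frame
vectors, and on the others they all vanish. -/
lemma wedge_frame_ne_zero {p : ℕ} (hpN : p ≤ N) {ω : Fin p → Dual ℝ V}
    (hli : LinearIndependent ℝ ω)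
    (hω : ∀ i : Fin N, p ≤ (i : ℕ) → ∀ j, ω j (e i) = 0) :
    wedge ω (fun k => e (Fin.castLE hpN k)) ≠ 0 := by
  rw [wedge_apply]
  intro h
  obtain ⟨a, ha, hMa⟩ := Matrix.exists_mulVec_eq_zero_iff.mpr h
  refine ha (funext fun i => Fintype.linearIndependent_iff.mp hli a ?_ i)
  refine e.ext fun i => ?_
  simp only [LinearMap.sum_apply, LinearMap.smul_apply, smul_eq_mul, LinearMap.zero_apply]
  by_cases hi : (i : ℕ) < p
  · have := congrFun hMa ⟨i, hi⟩
    simp only [Matrix.mulVec, dotProduct, Matrix.of_apply, Pi.zero_apply] at this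
    rw [← this]
    exact Finset.sum_congr rfl fun j _ => mul_comm _ _
  · simp [hω i (not_lt.mp hi)]

/-- Every tensor `c (g|_W - g|_{W^⊥})`, `c > 0`, along a frame is the superenergy tensor of a
form of causal type. -/
lemma exists_causal_superenergy (he : IsOrthonormalFrame g e) (he' : IsOrthonormalFrame g e')
    {p : ℕ} (hp : 1 ≤ p) (hpN : p ≤ N) {c : ℝ} (hc : 0 < c) {T : LinearMap.BilinForm ℝ V}
    (hT : ∀ i j, T (e' i) (e' j) = c * (if (i : ℕ) < p then 1 else -1) * g (e' i) (e' j)) :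
    ∃ Ω : V [⋀^Fin p]→ₗ[ℝ] ℝ, IsCausalSimple e Ω ∧ ∀ u v, T u v = superenergy g e Ω u v := by
  obtain ⟨ω, hli, hω, h1, h2⟩ := exists_causal_forms e' hp hpN
  set d := wedge ω (fun k => e' (Fin.castLE hpN k)) with hd
  have hd0 : d ≠ 0 := wedge_frame_ne_zero hpN hli hω
  -- Scaling every factor by `s` multiplies the frame component `d` by `s ^ p`; its square must be
  -- `2 * c` because of the factor `1 / 2` in the superenergy.
  set s : ℝ := (√(2 * c) / |d|) ^ ((p : ℝ)⁻¹) with hs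
  have hq : 0 < √(2 * c) / |d| := div_pos (Real.sqrt_pos.mpr (by linarith)) (abs_pos.mpr hd0)
  have hs0 : 0 < s := Real.rpow_pos_of_pos hq _
  have hsp : s ^ p = √(2 * c) / |d| := Real.rpow_inv_natCast_pow hq.le (by omega)
  have hdot : ∀ j, dot e (s • ω j) (s • ω j) = s * s * dot e' (ω j) (ω j) := fun j => by
    rw [dot_smul_smul, dot_eq he he']
  have hli' : LinearIndependent ℝ (fun j => s • ω j) :=
    hli.units_smul fun _ => Units.mk0 s hs0.ne'
  refine ⟨wedge fun j => s • ω j, ⟨fun j => s • ω j, hli', rfl, fun hp1 i => ?_,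
    fun hp1 i => ⟨hli'.ne_zero i, ?_⟩⟩, eq_superenergy_of_basis e' fun i j => ?_⟩
  · rw [hdot]
    exact mul_nonneg (by positivity) (h1 hp1 i)
  · rw [hdot, (h2 hp1 i).2, mul_zero]
  · have hdet : wedge (fun j => s • ω j) (fun k => e' (Fin.castLE hpN k)) = s ^ p * d := by
      rw [hd, wedge_apply, wedge_apply]
      have : (Matrix.of fun (k j : Fin p) => (s • ω j) (e' (Fin.castLE hpN k))) =
          s • Matrix.of fun (k j : Fin p) => ω j (e' (Fin.castLE hpN k)) := by
        ext; simp
      rw [this, Matrix.det_smul, Fintype.card_fin]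
    have hsq : (s ^ p * d) ^ 2 = 2 * c := by
      rw [hsp, mul_pow, div_pow, Real.sq_sqrt (by linarith), sq_abs]
      field_simp
    rw [superenergy_wedge he he' hp hpN _ (fun i hi j => by simp [hω i hi j]), hdet, hsq, hT]
    ring

/-- The span of `p ≥ 2` independent null vectors contains a timelike vector. -/
lemma IsOrthonormalFrame.exists_timelike_of_null (he : IsOrthonormalFrame g e) (hN : 1 ≤ N)
    {a b : V} (hab : LinearIndependent ℝ ![a, b]) (ha : g a a = 0) (hb : g b b = 0) :
    ∃ t : ℝ, 0 < g (a + t • b) (a + t • b) := by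
  have h0 : g a b ≠ 0 := by
    intro h
    have hpar := he.parallel_of_null (t := e ⟨0, hN⟩) (by rw [he.apply_first hN]; norm_num)
      ha hb h
    have := LinearIndependent.pair_iff.mp hab (g b (e ⟨0, hN⟩)) (-g a (e ⟨0, hN⟩))
      (by rw [hpar, neg_smul, add_neg_cancel])
    refine hab.ne_zero 1 (he.eq_zero_of_orthogonal (u := e ⟨0, hN⟩) ?_ this.1 hb.ge)
    rw [he.apply_first hN]; norm_num
  -- With this `t` the square is `2 (g a b)²`.
  refine ⟨g a b, ?_⟩
  simp only [map_add, map_smul, LinearMap.add_apply, LinearMap.smul_apply, smul_eq_mul, ha, hb,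
    he.symm b a]
  have := mul_self_pos.mpr h0
  linarith

/-- Trace and square of the superenergy tensor of a form of causal type. -/
lemma trace_of_causal_superenergy (he : IsOrthonormalFrame g e) (hN : 2 ≤ N) {p : ℕ} (hp : 1 ≤ p)
    (hpN : p ≤ N) {Ω : V [⋀^Fin p]→ₗ[ℝ] ℝ} (hΩ : IsCausalSimple e Ω)
    {T : LinearMap.BilinForm ℝ V} (hT : ∀ u v, T u v = superenergy g e Ω u v) {f : ℝ}
    (hTT : ∀ u v, cross e T T u v = f * g u v) (hf : f ≠ 0) :
    metricTrace e T = (2 * (p : ℝ) - N) * √f := by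
  obtain ⟨ω, hli, rfl, h1, h2⟩ := hΩ
  have hN1 : 1 ≤ N := by omega
  have hfirst : ∀ {c : ℝ}, (∀ u v, cross e T T u v = c * g u v) → f = c := fun h => by
    have := (hTT (e ⟨0, hN1⟩) (e ⟨0, hN1⟩)).symm.trans (h _ _)
    simpa [he.apply_first hN1] using this
  obtain ⟨u, huW, hu⟩ : ∃ u ∈ Submodule.span ℝ (Set.range fun j => sharp e (ω j)), 0 < g u u := by
    rcases hp.eq_or_lt with hp1 | hp1
    · subst hp1
      refine ⟨sharp e (ω 0), Submodule.subset_span ⟨0, rfl⟩, ?_⟩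
      rw [he.sharp_dot]
      -- A null 1-form would give `T = k ⊗ k`, whose square is zero, against `f ≠ 0`.
      refine lt_of_le_of_ne (h1 rfl 0) fun h0 => hf (hfirst fun u v => ?_)
      have hω : ω = fun _ => ω 0 := funext fun i => by rw [Subsingleton.elim i 0]
      have hTk : ∀ u v, T u v = ω 0 u * ω 0 v := fun u v => by
        rw [hT, hω, superenergy_oneForm he hN, ← h0]; ring
      rw [zero_mul]
      calc cross e T T u v = ω 0 u * ω 0 v * dot e (ω 0) (ω 0) := by
            simp only [cross, hTk, dot, Finset.mul_sum]
            exact Finset.sum_congr rfl fun i _ => by ring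
        _ = 0 := by rw [← h0, mul_zero]
    · have hli2 : LinearIndependent ℝ ![sharp e (ω ⟨0, hp⟩), sharp e (ω ⟨1, hp1⟩)] := by
        have := (hli.map' (sharp e) (LinearMap.ker_eq_bot.mpr he.sharp_injective)).comp
          ![(⟨0, hp⟩ : Fin p), ⟨1, hp1⟩] (by
            intro i j hij
            fin_cases i <;> fin_cases j <;> simp_all)
        have heq : ![sharp e (ω ⟨0, hp⟩), sharp e (ω ⟨1, hp1⟩)] =
            (sharp e ∘ ω) ∘ ![(⟨0, hp⟩ : Fin p), ⟨1, hp1⟩] := by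
          funext i
          fin_cases i <;> rfl
        rw [heq]
        exact this
      obtain ⟨t, ht⟩ := he.exists_timelike_of_null hN1 hli2
        (by rw [he.sharp_dot]; exact (h2 hp1 _).2) (by rw [he.sharp_dot]; exact (h2 hp1 _).2)
      exact ⟨_, Submodule.add_mem _ (Submodule.subset_span ⟨_, rfl⟩)
        (Submodule.smul_mem _ _ (Submodule.subset_span ⟨_, rfl⟩)), ht⟩
  obtain ⟨e', he', hω⟩ := he.exists_adapted_forms hli huW hu
  have hdiag := fun i j => (hT _ _).trans (superenergy_wedge he he' hp hpN ω hω i j)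
  have hf2 := hfirst fun u v => by
    rw [← cross_eq he he', cross_of_diag he' hdiag]
  rw [← metricTrace_eq he he', metricTrace_of_diag he' hpN hdiag, hf2,
    Real.sqrt_sq (by positivity)]

/-- For negative `f`, raising the index of `T` would send two orthogonal spacelike vectors to two
orthogonal timelike ones. The second spacelike vector is what needs `3 ≤ N`. -/
lemma IsOrthonormalFrame.nonneg_of_cross (he : IsOrthonormalFrame g e) (hN : 3 ≤ N)
    {T : LinearMap.BilinForm ℝ V} {f : ℝ} (hTT : ∀ u v, cross e T T u v = f * g u v) :
    0 ≤ f := by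
  by_contra hf
  push Not at hf
  have hval := fun u v => (he.cross_eq_apply T u v).symm.trans (hTT u v)
  set a := e ⟨1, by omega⟩
  set b := e ⟨2, by omega⟩
  have haa : g a a = -1 := by simp [a, he _ _, sgn]
  have hbb : g b b = -1 := by simp [b, he _ _, sgn]
  have hba : g b a = 0 := by simp [a, b, he _ _]
  have h0 := he.eq_zero_of_orthogonal (u := sharp e (T a)) (x := sharp e (T b))
    (by rw [hval, haa]; linarith) (by rw [hval, hba, mul_zero]) (by rw [hval, hbb]; linarith)
  have := hval b b
  rw [h0, hbb] at this
  simp at this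
  exact hf.ne this

/-- A symmetric tensor with vanishing square is a multiple of `k ⊗ k` for a null 1-form `k`. -/
lemma exists_null_of_cross_eq_zero (he : IsOrthonormalFrame g e) (hN : 2 ≤ N)
    {T : LinearMap.BilinForm ℝ V} (hT : ∀ u v, T u v = T v u)
    (hTT : ∀ u v, cross e T T u v = 0) :
    ∃ (β : ℝ) (k : Dual ℝ V), IsNull e k ∧ ∀ u v, T u v = β * (k u * k v) := by
  have hval := fun u v => (he.cross_eq_apply T u v).symm.trans (hTT u v)
  have hfirst := he.apply_first (show 0 < N by omega)
  by_cases hw : ∃ w, T w w ≠ 0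
  · obtain ⟨w, hw⟩ := hw
    refine ⟨(T w w)⁻¹, T w, ⟨fun h => hw (by rw [h]; rfl), ?_⟩, fun u v => ?_⟩
    · rw [← he.sharp_dot]; exact hval w w
    -- Chosen so that `T u' w = 0`. The raised `T w` and `T u'` are parallel, and pairing the
    -- relation with `w` kills the time component of `T u'`; being null, `T u'` vanishes.
    · set u' := T w w • u - T w u • w
      have hb : T u' = 0 := by
        have hpar := he.parallel_of_null (by rw [hfirst]; exact one_pos) (hval w w) (hval u' u')
          (hval w u')
        have := congrArg (fun x => g x w) hpar
        simp only [map_smul, LinearMap.smul_apply, smul_eq_mul, he.sharp_apply] at this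
        have hu'w : T u' w = 0 := by simp [u', hT u w]; ring
        rw [hu'w, mul_zero] at this
        have hz : T u' (e ⟨0, by omega⟩) = 0 := (mul_eq_zero.mp this).resolve_right hw
        apply he.sharp_injective
        rw [map_zero]
        exact he.eq_zero_of_orthogonal (by rw [hfirst]; exact one_pos)
          (by rw [he.sharp_apply]; exact hz) (hval u' u').ge
      have := congrArg (fun F : Dual ℝ V => F v) hb
      simp [u'] at this
      field_simp
      linarith
  -- Polarization gives `T = 0`, so `β = 0` works with any null 1-form.
  · push Not at hw
    refine ⟨0, e.coord ⟨0, by omega⟩ + e.coord ⟨1, by omega⟩, ⟨fun h => ?_, ?_⟩, fun u v => ?_⟩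
    · have := congrArg (fun F : Dual ℝ V => F (e ⟨0, by omega⟩)) h
      simp at this
    · rw [dot_add_add, dot_coord, dot_coord, dot_coord]
      simp [sgn]
    · have h := hw (u + v)
      simp only [map_add, LinearMap.add_apply, hw] at h
      have := hT u v
      linarith

/-- The trace term in `superenergy_oneForm` drops out for a null 1-form, so `√β • k` has superenergy
`β k ⊗ k`. -/
lemma mem_NS_of_isNull (he : IsOrthonormalFrame g e) (hN : 2 ≤ N) {k : Dual ℝ V}
    (hk : IsNull e k) {β : ℝ} (hβ : 0 < β) {T : LinearMap.BilinForm ℝ V}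
    (hT : ∀ u v, T u v = β * (k u * k v)) : T ∈ NS g e := by
  have hs := Real.sqrt_pos.mpr hβ
  have hdot : dot e (√β • k) (√β • k) = 0 := by rw [dot_smul_smul, hk.2, mul_zero]
  refine ⟨1, le_rfl, by omega, wedge fun _ => √β • k, ⟨⟨_, LinearIndependent.of_subsingleton 0
    (smul_ne_zero hs.ne' hk.1), rfl⟩, ?_⟩, fun u v => ?_⟩
  · rw [← hdot, formDot, dot]
    refine Fintype.sum_equiv (Equiv.funUnique (Fin 1) (Fin N)) _ _ fun I => ?_
    simp [wedge_apply]
  · rw [superenergy_oneForm he hN, hdot, hT]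
    simp only [LinearMap.smul_apply, smul_eq_mul]
    linear_combination (-(k u * k v)) * Real.mul_self_sqrt hβ.le

end Classification

end SuperEnergy

theorem mainTheorem1 {V : Type*} [AddCommGroup V] [Module ℝ V] {N : ℕ} (hN : 2 ≤ N)
    (g : LinearMap.BilinForm ℝ V) (e : Module.Basis (Fin N) ℝ V)
    (he : SuperEnergy.IsOrthonormalFrame g e)
    (T : LinearMap.BilinForm ℝ V) (hT : ∀ u v, T u v = T v u) (f : ℝ)
    (hTT : ∀ u v, SuperEnergy.cross e T T u v = f * g u v)
    (hf : N = 2 → 0 ≤ f) :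
    (f = 0 →
      (∃ (β : ℝ) (k : Module.Dual ℝ V), SuperEnergy.IsNull e k ∧ ∀ u v, T u v = β * (k u * k v)) ∧
      (T ≠ 0 → T ∈ SuperEnergy.NS g e ∨ -T ∈ SuperEnergy.NS g e)) ∧
    (f ≠ 0 →
      0 < f ∧
      ∃ ε : ℝ, (ε = 1 ∨ ε = -1) ∧
        ε • T ∈ SuperEnergy.SS g e ∧
        (∃ p : ℕ, 1 ≤ p ∧ p ≤ N ∧
          ε * SuperEnergy.metricTrace e T = (2 * (p : ℝ) - (N : ℝ)) * √f) ∧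
        ∀ p : ℕ, 1 ≤ p → p ≤ N →
          (ε * SuperEnergy.metricTrace e T = (2 * (p : ℝ) - (N : ℝ)) * √f ↔
            ∃ Ω : V [⋀^Fin p]→ₗ[ℝ] ℝ, SuperEnergy.IsCausalSimple e Ω ∧
              ∀ u v, ε * T u v = SuperEnergy.superenergy g e Ω u v)) := by
  open SuperEnergy in
  constructor
  · rintro rfl
    obtain ⟨β, k, hk, hTk⟩ := exists_null_of_cross_eq_zero he hN hT
      (fun u v => by rw [hTT, zero_mul])
    refine ⟨⟨β, k, hk, hTk⟩, fun hT0 => ?_⟩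
    rcases lt_trichotomy β 0 with h | h | h
    · exact Or.inr (mem_NS_of_isNull he hN hk (neg_pos.mpr h) fun u v => by
        rw [LinearMap.neg_apply, LinearMap.neg_apply, hTk, neg_mul])
    · refine absurd ?_ hT0
      ext u v
      rw [hTk, h, zero_mul]
      rfl
    · exact Or.inl (mem_NS_of_isNull he hN hk h hTk)
  · intro hf0
    have hfpos : 0 < f := by
      refine lt_of_le_of_ne ?_ hf0.symm
      rcases hN.eq_or_lt with h | h
      · exact hf h.symm
      · exact he.nonneg_of_cross h hTT
    refine ⟨hfpos, ?_⟩
    have hr : 0 < √f := Real.sqrt_pos.mpr hfpos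
    obtain ⟨ε, hε, p, hp, hpN, e', he', hdiag⟩ := exists_frame_diag he (by omega) hT hTT hfpos
    have htr : ε * metricTrace e T = metricTrace e (ε • T) := by
      simp only [metricTrace, Finset.mul_sum, LinearMap.smul_apply, smul_eq_mul]
      exact Finset.sum_congr rfl fun i _ => by ring
    have htrace : metricTrace e (ε • T) = (2 * (p : ℝ) - N) * √f := by
      rw [← metricTrace_eq he he', metricTrace_of_diag he' hpN hdiag]
    have hcross : ∀ u v, cross e (ε • T) (ε • T) u v = f * g u v := fun u v => by
      rw [← cross_eq he he', cross_of_diag he' hdiag, Real.sq_sqrt hfpos.le]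
    obtain ⟨Ω, hΩ, hTΩ⟩ := exists_causal_superenergy he he' hp hpN hr hdiag
    refine ⟨ε, hε, ⟨p, hp, hpN, Ω, ?_, hTΩ⟩, ⟨p, hp, hpN, htr.trans htrace⟩,
      fun q hq hqN => ⟨fun h => ?_, fun ⟨Ω', hΩ', hTΩ'⟩ => ?_⟩⟩
    · obtain ⟨ω, hli, h, -⟩ := hΩ
      exact ⟨ω, hli, h⟩
    · rw [htr, htrace] at h
      -- As `√f > 0`, the trace determines the degree, so the form already constructed has degree
      -- `q`.
      have hpq : (p : ℝ) = q := by
        have := mul_right_cancel₀ hr.ne' h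
        linarith
      obtain rfl : p = q := by exact_mod_cast hpq
      exact ⟨Ω, hΩ, hTΩ⟩
    · rw [htr]
      exact trace_of_causal_superenergy he hN hq hqN hΩ' hTΩ' hcross hf0
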